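/- \textbf{Setting.} Let $m\ge 1$ be the number of options and $d=n_{obj}\ge 0$ the number of parameters. An observation $k$ consists of explanatory vectors $x_1^k,\dots,x_m^k\in\mathbb{R}^d$ and a chosen option $c^k\in\{1,\dots,m\}$. The softmax (conditional logit) model with parameter $\theta\in\mathbb{R}^d$ is $$p_i^k(\theta)=\Pr(c^k=i\mid x^k,\theta)=\frac{\exp(\theta^T x_i^k)}{\sum_{j=1}^m\exp(\theta^T x_j^k)},$$ and the log-likelihood of the first $n$ observations is $\ell_n(\theta)=\sum_{k=1}^n\log p^k_{c^k}(\theta)$. Let $X^k=[\,x_1^k-x_m^k\ \cdots\ x_{m-1}^k-x_m^k\ \ 0\,]$, a $d\times m$ matrix (so $X^k=[x_1^k\cdots x_{m-1}^k\ 0]$ for data normalized by $x_m^k=0$), and $S_n=\frac1n\sum_{k=1}^n X^k(X^k)^T$. Write $H_n$ for the Hessian of $\ell_n$. \textbf{Theorem (convergence of the ML estimator).} 1. For all data, $-\ell_n$ is convex on $\mathbb{R}^d$, so the maximum-likelihood problem $\max_{\theta\in\mathbb{R}^d}\ell_n(\theta)$ is a convex optimization problem; if $S_n$ is positive definite, then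 $-\ell_n$ is strictly convex. 2. Suppose that the observations $(x^k,c^k)$, $k=1,2,\dots$, are independent and identically distributed, that $c^k$ follows the softmax model with parameter $\theta_0$ conditionally on $x^k$, that the second-moment matrix $\mathbb{E}[X^k(X^k)^T]$ exists (its entries are integrable), and that for some sample size $n$ the empirical matrix $S_n$ is positive definite with positive probability. Let $\hat\theta_n$ be a maximum-likelihood estimator, that is, a random vector that almost surely maximizes $\ell_n$ whenever a maximizer exists. Put $\hat J_n=-H_n(\hat\theta_n)/n$ and let $J=-\mathbb{E}[H(\theta_0)]$, where $H$ is the Hessian of the log-likelihood of a single observation. Then: (a) almost surely, for all sufficiently large $n$, $\hat\theta_n$ is the unique maximizer of $\ell_n$, and $\hat\theta_n\to\theta_0$; (b) $J$ exists and is positive definite, and $\hat J_n\to J$ almost surely; (c) $\hat\theta_n$ is asymptotically distributed as $\mathcal N(\theta_0,\hat J_n^{-1}/n)$: as $n\to\infty$, in distribution, $$\sqrt n\,(\hat\theta_n-\theta_0)\to\mathcal N(0,J^{-1})\qquad\text{and}\qquad \hat J_n^{1/2}\sqrt n\,(\hat\theta_n-\theta_0)\to\mathcal N(0,I).$$ 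-/

import Mathlib

open MeasureTheory ProbabilityTheory Filter Topology
open scoped MatrixOrder

noncomputable section

/-- The explanatory variables of one observation: one vector in `ℝ^d` for each of the
`M + 1` options (so `m = M + 1`; the last option is `Fin.last M`). -/
abbrev Explanatory (d M : ℕ) : Type := Fin (M + 1) → EuclideanSpace ℝ (Fin d)

/-- The softmax (conditional logit) probability of option `i`,
`exp (θᵀ x_i) / ∑ j, exp (θᵀ x_j)`. -/
def choiceProb {d M : ℕ} (θ : EuclideanSpace ℝ (Fin d)) (x : Explanatory d M)
    (i : Fin (M + 1)) : ℝ :=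
  Real.exp (inner ℝ θ (x i)) / ∑ j, Real.exp (inner ℝ θ (x j))

/-- The log-likelihood `ℓ(θ) = ∑_{k < n} log Pr(y^k | x^k, θ)` of the first `n` observations,
where `c k` is the option chosen in observation `k` (the index of the entry `1` of the one-hot
response vector `y^k`). -/
def logLik {d M : ℕ} (n : ℕ) (x : ℕ → Explanatory d M) (c : ℕ → Fin (M + 1))
    (θ : EuclideanSpace ℝ (Fin d)) : ℝ :=
  ∑ k ∈ Finset.range n, Real.log (choiceProb θ (x k) (c k))

/-- The explanatory variables measured relative to the last option, `x_i - x_m`. This does not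
change the choice probabilities. -/
def relToLast {d M : ℕ} (x : Explanatory d M) : Explanatory d M :=
  fun i => x i - x (Fin.last M)

/-- The `d × m` matrix `[x_1 x_2 ⋯ x_{m-1} 0]`. -/
def designMatrix {d M : ℕ} (x : Explanatory d M) : Matrix (Fin d) (Fin (M + 1)) ℝ :=
  Matrix.of fun a i => if i = Fin.last M then 0 else x i a

/-- The empirical second-moment matrix `(1/n) ∑_{k < n} X^k (X^k)ᵀ`, where
`X^k = [x_1^k - x_m^k ⋯ x_{m-1}^k - x_m^k 0]`; if the data are normalized by `x_m^k = 0`, then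
`X^k = [x_1^k ⋯ x_{m-1}^k 0]`. -/
def empiricalSecondMoment {d M : ℕ} (n : ℕ) (x : ℕ → Explanatory d M) :
    Matrix (Fin d) (Fin d) ℝ :=
  (n : ℝ)⁻¹ • ∑ k ∈ Finset.range n,
    designMatrix (relToLast (x k)) * (designMatrix (relToLast (x k))).transpose

/-- The Hessian matrix of `f : ℝ^d → ℝ` at `θ`. -/
def hessian {d : ℕ} (f : EuclideanSpace ℝ (Fin d) → ℝ) (θ : EuclideanSpace ℝ (Fin d)) :
    Matrix (Fin d) (Fin d) ℝ :=
  Matrix.of fun a b =>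
    iteratedFDeriv ℝ 2 f θ ![EuclideanSpace.single a 1, EuclideanSpace.single b 1]

/-- The empirical mean Hessian `Ĵ(θ) = - H(θ) / n`, where `H` is the Hessian of the
log-likelihood of the first `n` observations. -/
def empiricalInfo {d M : ℕ} (n : ℕ) (x : ℕ → Explanatory d M) (c : ℕ → Fin (M + 1))
    (θ : EuclideanSpace ℝ (Fin d)) : Matrix (Fin d) (Fin d) ℝ :=
  -((n : ℝ)⁻¹ • hessian (logLik n x c) θ)

/-- The observations `(x^k, y^k)` are independent and identically distributed, and the option
`c k` chosen in observation `k` follows the softmax model with parameter `θ₀` conditionally on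
`x^k`. -/
structure IsSoftmaxSample {d M : ℕ} {Ω : Type*} [MeasurableSpace Ω] (P : Measure Ω)
    (θ₀ : EuclideanSpace ℝ (Fin d)) (x : ℕ → Ω → Explanatory d M)
    (c : ℕ → Ω → Fin (M + 1)) : Prop where
  measurable_x : ∀ k, Measurable (x k)
  measurable_c : ∀ k, Measurable (c k)
  indep : iIndepFun (fun k ω => (x k ω, c k ω)) P
  ident : ∀ k, IdentDistrib (fun ω => (x k ω, c k ω)) (fun ω => (x 0 ω, c 0 ω)) P P
  condProb : ∀ k i, P⟦c k ⁻¹' {i} | MeasurableSpace.comap (x k) inferInstance⟧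
    =ᵐ[P] fun ω => choiceProb θ₀ (x k ω) i

/-- `θhat n` is a maximum likelihood estimator from the first `n` observations: a random vector
that maximizes the log-likelihood whenever a maximizer exists. (For some data none exists; there
the value is arbitrary.) -/
structure IsMLEstimator {d M : ℕ} {Ω : Type*} [MeasurableSpace Ω] (P : Measure Ω)
    (x : ℕ → Ω → Explanatory d M) (c : ℕ → Ω → Fin (M + 1))
    (θhat : ℕ → Ω → EuclideanSpace ℝ (Fin d)) : Prop where
  aemeasurable : ∀ n, AEMeasurable (θhat n) P
  isMax : ∀ n, ∀ᵐ ω ∂P,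
    (∃ θ, IsMaxOn (logLik n (fun k => x k ω) (fun k => c k ω)) Set.univ θ) →
      IsMaxOn (logLik n (fun k => x k ω) (fun k => c k ω)) Set.univ (θhat n ω)

/-- The negative of the Hessian at `θ` of the log-likelihood of the single observation with
explanatory variables `x` and chosen option `c`. -/
def obsInfo {d M : ℕ} (x : Explanatory d M) (c : Fin (M + 1))
    (θ : EuclideanSpace ℝ (Fin d)) : Matrix (Fin d) (Fin d) ℝ :=
  -hessian (fun t => Real.log (choiceProb t x c)) θ

/-- The (per-observation) information matrix `J = - E[H(θ₀)]`. -/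
def infoMatrix {d M : ℕ} {Ω : Type*} [MeasurableSpace Ω] (P : Measure Ω)
    (θ₀ : EuclideanSpace ℝ (Fin d)) (x : ℕ → Ω → Explanatory d M)
    (c : ℕ → Ω → Fin (M + 1)) : Matrix (Fin d) (Fin d) ℝ :=
  Matrix.of fun a b => ∫ ω, obsInfo (x 0 ω) (c 0 ω) θ₀ a b ∂P

end

/-! The log-likelihood of one observation is a linear function of `θ` minus a log-sum-exp. Its
gradient is `x c` minus the mean of the options under the choice probabilities, and its Hessian is
minus their covariance, whatever option was chosen. Jensen's inequality for `exp` puts it below its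
tangent planes (`log_choiceProb_le_tangent`), strictly in directions that separate two options;
positive definiteness of the empirical second moment excludes all other directions. This gives the
convexity claims.

The asymptotics split into a deterministic and a probabilistic half. `mle_consistent_and_linear`
fixes one data sequence: if the empirical information converges jointly in `n` and `θ → θ₀` to a
positive definite `J`, and the mean score at `θ₀` tends to 0, then convexity turns local control
near `θ₀` into global existence, uniqueness and consistency, and `θhat n - θ₀` equals `J⁻¹` times
the mean score up to a relative error tending to 0. No compact parameter space is needed.

The probabilistic half supplies these hypotheses almost surely. A locally uniform law of large
numbers (`ae_tendsto_average_nhds`) applies because the covariance is bounded, uniformly in `θ`, by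
a multiple of the squared norm of the relative data. At `θ₀` the score has mean zero and covariance
`J`, so it obeys the strong law and the central limit theorem. Slutsky arguments carry the Gaussian
limit over to the estimator and then through the random matrix square root. -/

noncomputable section

/-! ### Derivatives, bounds and the tangent inequality for the softmax model. -/

section SoftmaxCalculus

variable {d M : ℕ}

lemma sum_exp_inner_pos (θ : EuclideanSpace ℝ (Fin d)) (x : Explanatory d M) :
    0 < ∑ j, Real.exp (inner ℝ θ (x j)) :=
  Finset.sum_pos (fun _ _ => Real.exp_pos _) Finset.univ_nonempty

lemma choiceProb_pos (θ : EuclideanSpace ℝ (Fin d)) (x : Explanatory d M) (i : Fin (M + 1)) :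
    0 < choiceProb θ x i :=
  div_pos (Real.exp_pos _) (sum_exp_inner_pos θ x)

lemma sum_choiceProb (θ : EuclideanSpace ℝ (Fin d)) (x : Explanatory d M) :
    ∑ i, choiceProb θ x i = 1 := by
  simp only [choiceProb, ← Finset.sum_div]
  exact div_self (sum_exp_inner_pos θ x).ne'

lemma choiceProb_le_one (θ : EuclideanSpace ℝ (Fin d)) (x : Explanatory d M) (i : Fin (M + 1)) :
    choiceProb θ x i ≤ 1 := by
  rw [← sum_choiceProb θ x]
  exact Finset.single_le_sum (f := fun i => choiceProb θ x i)
    (fun j _ => (choiceProb_pos θ x j).le) (Finset.mem_univ i)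

lemma log_choiceProb (θ : EuclideanSpace ℝ (Fin d)) (x : Explanatory d M) (i : Fin (M + 1)) :
    Real.log (choiceProb θ x i) =
      inner ℝ θ (x i) - Real.log (∑ j, Real.exp (inner ℝ θ (x j))) := by
  rw [choiceProb, Real.log_div (Real.exp_pos _).ne' (sum_exp_inner_pos θ x).ne', Real.log_exp]

/-- A common shift of the options cancels in the quotient. The probabilistic estimates use relative
vectors throughout, since only their second moments are assumed finite. -/
lemma choiceProb_relToLast (θ : EuclideanSpace ℝ (Fin d)) (x : Explanatory d M)
    (i : Fin (M + 1)) : choiceProb θ (relToLast x) i = choiceProb θ x i := by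
  simp only [choiceProb, relToLast, inner_sub_right, Real.exp_sub, ← Finset.sum_div]
  have := sum_exp_inner_pos θ x
  have := Real.exp_pos (inner ℝ θ (x (Fin.last M)))
  field_simp

lemma relToLast_last (x : Explanatory d M) : relToLast x (Fin.last M) = 0 := by
  simp [relToLast]

lemma obsInfo_relToLast (x : Explanatory d M) (c : Fin (M + 1)) :
    obsInfo (relToLast x) c = obsInfo x c := by
  funext θ
  simp only [obsInfo, choiceProb_relToLast]

lemma continuous_relToLast : Continuous (relToLast : Explanatory d M → Explanatory d M) := by
  unfold relToLast
  fun_prop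

/-- The mean of the explanatory vectors under the choice probabilities. -/
def choiceMean (θ : EuclideanSpace ℝ (Fin d)) (x : Explanatory d M) :
    EuclideanSpace ℝ (Fin d) :=
  ∑ i, choiceProb θ x i • x i

/-- The gradient of the log-likelihood of one observation. -/
def score (x : Explanatory d M) (c : Fin (M + 1)) (θ : EuclideanSpace ℝ (Fin d)) :
    EuclideanSpace ℝ (Fin d) :=
  x c - choiceMean θ x

/-- The covariance matrix of the explanatory vectors under the choice probabilities. -/
def choiceCov (θ : EuclideanSpace ℝ (Fin d)) (x : Explanatory d M) :
    Matrix (Fin d) (Fin d) ℝ :=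
  Matrix.of fun a b => ∑ i, choiceProb θ x i * (score x i θ a * score x i θ b)

lemma sum_choiceProb_smul_score (θ : EuclideanSpace ℝ (Fin d)) (x : Explanatory d M) :
    ∑ i, choiceProb θ x i • score x i θ = 0 := by
  simp only [score, smul_sub, Finset.sum_sub_distrib, ← Finset.sum_smul, sum_choiceProb,
    one_smul]
  simp [choiceMean]

lemma continuous_choiceProb (i : Fin (M + 1)) :
    Continuous fun q : EuclideanSpace ℝ (Fin d) × Explanatory d M => choiceProb q.1 q.2 i := by
  unfold choiceProb
  refine Continuous.div (by fun_prop) (by fun_prop) fun q => (sum_exp_inner_pos q.1 q.2).ne'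

lemma continuous_choiceMean :
    Continuous fun q : EuclideanSpace ℝ (Fin d) × Explanatory d M => choiceMean q.1 q.2 := by
  unfold choiceMean
  refine continuous_finsetSum _ fun i _ => (continuous_choiceProb i).smul (by fun_prop)

lemma continuous_score (i : Fin (M + 1)) :
    Continuous fun q : EuclideanSpace ℝ (Fin d) × Explanatory d M => score q.2 i q.1 := by
  unfold score
  exact Continuous.sub (by fun_prop) continuous_choiceMean

lemma continuous_choiceCov :
    Continuous fun q : EuclideanSpace ℝ (Fin d) × Explanatory d M => choiceCov q.1 q.2 := by
  refine continuous_matrix fun a b => ?_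
  have h (i : Fin (M + 1)) (a : Fin d) :
      Continuous fun q : EuclideanSpace ℝ (Fin d) × Explanatory d M => score q.2 i q.1 a := by
    have := continuous_score (d := d) (M := M) i
    fun_prop
  simp only [choiceCov, Matrix.of_apply]
  exact continuous_finsetSum _ fun i _ =>
    Continuous.mul (continuous_choiceProb i) (Continuous.mul (h i a) (h i b))

lemma norm_choiceMean_le (θ : EuclideanSpace ℝ (Fin d)) (x : Explanatory d M) :
    ‖choiceMean θ x‖ ≤ ‖x‖ := by
  calc ‖choiceMean θ x‖ ≤ ∑ i, ‖choiceProb θ x i • x i‖ := norm_sum_le _ _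
    _ ≤ ∑ i, choiceProb θ x i * ‖x‖ := by
      refine Finset.sum_le_sum fun i _ => ?_
      rw [norm_smul, Real.norm_of_nonneg (choiceProb_pos θ x i).le]
      exact mul_le_mul_of_nonneg_left (norm_le_pi_norm x i) (choiceProb_pos θ x i).le
    _ = ‖x‖ := by rw [← Finset.sum_mul, sum_choiceProb, one_mul]

lemma norm_score_le (θ : EuclideanSpace ℝ (Fin d)) (x : Explanatory d M) (i : Fin (M + 1)) :
    ‖score x i θ‖ ≤ 2 * ‖x‖ := by
  have h1 := norm_sub_le (x i) (choiceMean θ x)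
  have h2 := norm_le_pi_norm x i
  have h3 := norm_choiceMean_le θ x
  unfold score
  linarith

/-- The bound is free of `θ`: this is the domination that the uniform law of large numbers requires.
-/
lemma abs_choiceCov_le (θ : EuclideanSpace ℝ (Fin d)) (x : Explanatory d M) (a b : Fin d) :
    |choiceCov θ x a b| ≤ 4 * ‖x‖ ^ 2 := by
  have h (i : Fin (M + 1)) (a : Fin d) : |score x i θ a| ≤ 2 * ‖x‖ :=
    (PiLp.norm_apply_le (score x i θ) a).trans (norm_score_le θ x i)
  calc |choiceCov θ x a b|
      ≤ ∑ i, |choiceProb θ x i * (score x i θ a * score x i θ b)| :=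
        by simpa only [choiceCov, Matrix.of_apply] using Finset.abs_sum_le_sum_abs _ _
    _ ≤ ∑ i, choiceProb θ x i * (4 * ‖x‖ ^ 2) := by
      refine Finset.sum_le_sum fun i _ => ?_
      rw [abs_mul, abs_of_pos (choiceProb_pos θ x i), abs_mul]
      refine mul_le_mul_of_nonneg_left ?_ (choiceProb_pos θ x i).le
      calc |score x i θ a| * |score x i θ b| ≤ (2 * ‖x‖) * (2 * ‖x‖) :=
            mul_le_mul (h i a) (h i b) (abs_nonneg _) (by positivity)
        _ = 4 * ‖x‖ ^ 2 := by ring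
    _ = 4 * ‖x‖ ^ 2 := by rw [← Finset.sum_mul, sum_choiceProb, one_mul]

lemma toEuclideanCLM_choiceCov_apply (θ : EuclideanSpace ℝ (Fin d)) (x : Explanatory d M)
    (v : EuclideanSpace ℝ (Fin d)) :
    Matrix.toEuclideanCLM (𝕜 := ℝ) (choiceCov θ x) v =
      ∑ i, (choiceProb θ x i * inner ℝ (score x i θ) v) • score x i θ := by
  ext a
  simp only [Matrix.ofLp_toEuclideanCLM, Matrix.mulVec, dotProduct, choiceCov, Matrix.of_apply,
    PiLp.inner_apply, WithLp.ofLp_sum, Finset.sum_apply, WithLp.ofLp_smul, Pi.smul_apply,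
    smul_eq_mul, Finset.sum_mul, Finset.mul_sum]
  rw [Finset.sum_comm]
  refine Finset.sum_congr rfl fun i _ => Finset.sum_congr rfl fun b _ => ?_
  simp only [RCLike.inner_apply, conj_trivial]
  ring

lemma inner_toEuclideanCLM_choiceCov (θ : EuclideanSpace ℝ (Fin d)) (x : Explanatory d M)
    (v w : EuclideanSpace ℝ (Fin d)) :
    inner ℝ v (Matrix.toEuclideanCLM (𝕜 := ℝ) (choiceCov θ x) w) =
      ∑ i, choiceProb θ x i * (inner ℝ v (score x i θ) * inner ℝ w (score x i θ)) := by
  rw [toEuclideanCLM_choiceCov_apply, inner_sum]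
  refine Finset.sum_congr rfl fun i _ => ?_
  rw [inner_smul_right, real_inner_comm w]
  ring

lemma choiceCov_comm (θ : EuclideanSpace ℝ (Fin d)) (x : Explanatory d M) (a b : Fin d) :
    choiceCov θ x a b = choiceCov θ x b a := by
  simp only [choiceCov, Matrix.of_apply, mul_comm]

lemma choiceCov_posSemidef (θ : EuclideanSpace ℝ (Fin d)) (x : Explanatory d M) :
    (choiceCov θ x).PosSemidef := by
  refine Matrix.PosSemidef.of_dotProduct_mulVec_nonneg
    (Matrix.IsHermitian.ext fun a b => by simp [choiceCov_comm θ x a b]) fun v => ?_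
  have := inner_toEuclideanCLM_choiceCov θ x (WithLp.toLp 2 v) (WithLp.toLp 2 v)
  rw [Matrix.inner_toEuclideanCLM] at this
  simp only [star_trivial]
  rw [this]
  exact Finset.sum_nonneg fun i _ => mul_nonneg (choiceProb_pos θ x i).le (mul_self_nonneg _)

lemma hasFDerivAt_inner_left (v θ : EuclideanSpace ℝ (Fin d)) :
    HasFDerivAt (fun t : EuclideanSpace ℝ (Fin d) => inner ℝ t v) (innerSL ℝ v) θ :=
  (innerSL ℝ v).hasFDerivAt.congr_of_eventuallyEq
    (Eventually.of_forall fun t => by simp [real_inner_comm])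

lemma hasFDerivAt_sum_exp_inner (θ : EuclideanSpace ℝ (Fin d)) (x : Explanatory d M) :
    HasFDerivAt (fun t : EuclideanSpace ℝ (Fin d) => ∑ j, Real.exp (inner ℝ t (x j)))
      ((∑ j, Real.exp (inner ℝ θ (x j))) • innerSL ℝ (choiceMean θ x)) θ := by
  have h (j : Fin (M + 1)) : HasFDerivAt
      (fun t : EuclideanSpace ℝ (Fin d) => Real.exp (inner ℝ t (x j)))
      (Real.exp (inner ℝ θ (x j)) • innerSL ℝ (x j)) θ :=
    (hasFDerivAt_inner_left (x j) θ).exp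
  refine (HasFDerivAt.fun_sum fun j _ => h j).congr_fderiv ?_
  ext v
  simp only [_root_.sum_apply, _root_.smul_apply, innerSL_apply_apply,
    smul_eq_mul, choiceMean, sum_inner, inner_smul_left, Finset.mul_sum, choiceProb, conj_trivial]
  refine Finset.sum_congr rfl fun j _ => ?_
  have := (sum_exp_inner_pos θ x).ne'
  field_simp

lemma hasFDerivAt_log_choiceProb (x : Explanatory d M) (c : Fin (M + 1))
    (θ : EuclideanSpace ℝ (Fin d)) :
    HasFDerivAt (fun t => Real.log (choiceProb t x c)) (innerSL ℝ (score x c θ)) θ := by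
  simp only [log_choiceProb]
  have h2 := (hasFDerivAt_sum_exp_inner θ x).log (sum_exp_inner_pos θ x).ne'
  rw [smul_smul, inv_mul_cancel₀ (sum_exp_inner_pos θ x).ne', one_smul] at h2
  refine ((hasFDerivAt_inner_left (x c) θ).sub h2).congr_fderiv ?_
  ext v
  simp [score]

/-- Differentiating `exp (log p)` avoids the quotient rule. -/
lemma hasFDerivAt_choiceProb (x : Explanatory d M) (i : Fin (M + 1))
    (θ : EuclideanSpace ℝ (Fin d)) :
    HasFDerivAt (fun t => choiceProb t x i) (choiceProb θ x i • innerSL ℝ (score x i θ)) θ := by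
  have := (hasFDerivAt_log_choiceProb x i θ).exp
  simpa only [Real.exp_log (choiceProb_pos _ x i)] using this

lemma hasFDerivAt_choiceMean (x : Explanatory d M) (θ : EuclideanSpace ℝ (Fin d)) :
    HasFDerivAt (fun t => choiceMean t x)
      (Matrix.toEuclideanCLM (𝕜 := ℝ) (choiceCov θ x)) θ := by
  refine (HasFDerivAt.fun_sum fun i _ =>
    (hasFDerivAt_choiceProb x i θ).smul_const (x i)).congr_fderiv ?_
  ext1 v
  rw [toEuclideanCLM_choiceCov_apply]
  simp only [_root_.sum_apply, ContinuousLinearMap.smulRight_apply,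
    _root_.smul_apply, innerSL_apply_apply, smul_eq_mul]
  -- The derivative comes out with `x i` where the covariance has `score x i θ`; the difference
  -- vanishes because the scores average to zero.
  have h0 : ∑ i, (choiceProb θ x i * inner ℝ (score x i θ) v) • choiceMean θ x = 0 := by
    rw [← Finset.sum_smul]
    have : ∑ i, choiceProb θ x i * inner ℝ (score x i θ) v
        = inner ℝ (∑ i, choiceProb θ x i • score x i θ) v := by
      simp [sum_inner, inner_smul_left]
    rw [this, sum_choiceProb_smul_score, inner_zero_left, zero_smul]
  rw [← sub_eq_zero, ← Finset.sum_sub_distrib, ← h0]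
  refine Finset.sum_congr rfl fun i _ => ?_
  rw [← smul_sub, score, sub_sub_cancel]

lemma hasFDerivAt_score (x : Explanatory d M) (c : Fin (M + 1))
    (θ : EuclideanSpace ℝ (Fin d)) :
    HasFDerivAt (fun t => score x c t)
      (-Matrix.toEuclideanCLM (𝕜 := ℝ) (choiceCov θ x)) θ :=
  (hasFDerivAt_choiceMean x θ).const_sub (x c)

/-- The transpose arises because entry `(a, b)` is the `b`-th coordinate of `A` applied to the
`a`-th basis vector; it disappears later by symmetry. -/
lemma hessian_eq_of_hasFDerivAt {f : EuclideanSpace ℝ (Fin d) → ℝ}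
    {g : EuclideanSpace ℝ (Fin d) → EuclideanSpace ℝ (Fin d)} {A : Matrix (Fin d) (Fin d) ℝ}
    {θ : EuclideanSpace ℝ (Fin d)} (hf : ∀ t, HasFDerivAt f (innerSL ℝ (g t)) t)
    (hg : HasFDerivAt g (Matrix.toEuclideanCLM (𝕜 := ℝ) A) θ) :
    hessian f θ = A.transpose := by
  ext a b
  have hfd : fderiv ℝ f = fun t => InnerProductSpace.toDual ℝ (EuclideanSpace ℝ (Fin d)) (g t) := by
    funext t
    exact (hf t).fderiv
  have hL : HasFDerivAt
      (fun t => InnerProductSpace.toDual ℝ (EuclideanSpace ℝ (Fin d)) (g t)) _ θ :=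
    ((InnerProductSpace.toDual ℝ
      (EuclideanSpace ℝ (Fin d))).toContinuousLinearEquiv.toContinuousLinearMap.hasFDerivAt).comp
      θ hg
  rw [hessian, Matrix.of_apply, iteratedFDeriv_two_apply, hfd, hL.fderiv]
  simp [EuclideanSpace.inner_single_right]

lemma hessian_logLik (n : ℕ) (x : ℕ → Explanatory d M) (c : ℕ → Fin (M + 1))
    (θ : EuclideanSpace ℝ (Fin d)) :
    hessian (logLik n x c) θ = -∑ k ∈ Finset.range n, choiceCov θ (x k) := by
  have hf (t : EuclideanSpace ℝ (Fin d)) : HasFDerivAt (logLik n x c)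
      (innerSL ℝ (∑ k ∈ Finset.range n, score (x k) (c k) t)) t := by
    rw [map_sum]
    exact HasFDerivAt.fun_sum fun k _ => hasFDerivAt_log_choiceProb (x k) (c k) t
  have hg : HasFDerivAt (fun t => ∑ k ∈ Finset.range n, score (x k) (c k) t)
      (Matrix.toEuclideanCLM (𝕜 := ℝ) (-∑ k ∈ Finset.range n, choiceCov θ (x k))) θ := by
    rw [map_neg, map_sum, ← Finset.sum_neg_distrib]
    exact HasFDerivAt.fun_sum fun k _ => hasFDerivAt_score (x k) (c k) θ
  rw [hessian_eq_of_hasFDerivAt hf hg]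
  ext a b
  simp [Matrix.sum_apply, choiceCov_comm θ _ a b]

lemma empiricalInfo_eq (n : ℕ) (x : ℕ → Explanatory d M) (c : ℕ → Fin (M + 1))
    (θ : EuclideanSpace ℝ (Fin d)) :
    empiricalInfo n x c θ = (n : ℝ)⁻¹ • ∑ k ∈ Finset.range n, choiceCov θ (x k) := by
  rw [empiricalInfo, hessian_logLik, smul_neg, neg_neg]

lemma empiricalInfo_posSemidef (n : ℕ) (x : ℕ → Explanatory d M) (c : ℕ → Fin (M + 1))
    (θ : EuclideanSpace ℝ (Fin d)) : (empiricalInfo n x c θ).PosSemidef := by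
  rw [empiricalInfo_eq]
  exact (Matrix.posSemidef_sum _ fun k _ => choiceCov_posSemidef θ (x k)).smul (by positivity)

lemma obsInfo_eq (x : Explanatory d M) (c : Fin (M + 1)) (θ : EuclideanSpace ℝ (Fin d)) :
    obsInfo x c θ = choiceCov θ x := by
  have := hessian_logLik 1 (fun _ => x) (fun _ => c) θ
  have h : logLik 1 (fun _ => x) (fun _ => c) = fun t => Real.log (choiceProb t x c) := by
    funext t
    simp [logLik]
  rw [h] at this
  simp [obsInfo, this]

/-- The log-likelihood lies below its tangent plane, by Jensen's inequality for `exp`. -/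
lemma log_choiceProb_le_tangent (x : Explanatory d M) (c : Fin (M + 1))
    (θ t : EuclideanSpace ℝ (Fin d)) :
    Real.log (choiceProb t x c) ≤
      Real.log (choiceProb θ x c) + inner ℝ (score x c θ) (t - θ) ∧
    ((∃ i, inner ℝ (relToLast x i) (t - θ) ≠ 0) →
      Real.log (choiceProb t x c) <
        Real.log (choiceProb θ x c) + inner ℝ (score x c θ) (t - θ)) := by
  set h : Fin (M + 1) → ℝ := fun i => inner ℝ (x i) (t - θ) with hh
  have hmean : inner ℝ (choiceMean θ x) (t - θ) = ∑ i, choiceProb θ x i • h i := by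
    simp [choiceMean, sum_inner, inner_smul_left, hh]
  have hsum : ∑ i, choiceProb θ x i • Real.exp (h i)
      = (∑ j, Real.exp (inner ℝ t (x j))) / ∑ j, Real.exp (inner ℝ θ (x j)) := by
    rw [Finset.sum_div]
    refine Finset.sum_congr rfl fun i _ => ?_
    simp only [hh, choiceProb, inner_sub_right, smul_eq_mul, Real.exp_sub,
      real_inner_comm _ (x i)]
    field_simp
  have hlog : Real.log (∑ i, choiceProb θ x i • Real.exp (h i))
      = Real.log (∑ j, Real.exp (inner ℝ t (x j)))
        - Real.log (∑ j, Real.exp (inner ℝ θ (x j))) := by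
    rw [hsum, Real.log_div (sum_exp_inner_pos t x).ne' (sum_exp_inner_pos θ x).ne']
  have hpos : 0 < ∑ i, choiceProb θ x i • Real.exp (h i) := by
    rw [hsum]
    exact div_pos (sum_exp_inner_pos t x) (sum_exp_inner_pos θ x)
  have hc : inner ℝ (x c) (t - θ) = inner ℝ t (x c) - inner ℝ θ (x c) := by
    rw [inner_sub_right, real_inner_comm t, real_inner_comm θ]
  -- The gap below the tangent plane is exactly the Jensen gap of `h` under the choice
  -- probabilities; the chosen option `c` drops out.
  have key : Real.log (choiceProb θ x c) + inner ℝ (score x c θ) (t - θ)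
      - Real.log (choiceProb t x c)
      = Real.log (∑ i, choiceProb θ x i • Real.exp (h i)) - ∑ i, choiceProb θ x i • h i := by
    rw [hlog, ← hmean, log_choiceProb, log_choiceProb, score, inner_sub_left, hc]
    ring
  constructor
  · have := convexOn_exp.map_sum_le (t := Finset.univ) (w := fun i => choiceProb θ x i) (p := h)
      (fun i _ => (choiceProb_pos θ x i).le) (sum_choiceProb θ x) (fun i _ => Set.mem_univ _)
    have := (Real.le_log_iff_exp_le hpos).2 this
    linarith
  · rintro ⟨i, hi⟩
    have hne : h i ≠ h (Fin.last M) := by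
      rw [relToLast, inner_sub_left] at hi
      exact sub_ne_zero.1 hi
    have := strictConvexOn_exp.map_sum_lt (t := Finset.univ) (w := fun i => choiceProb θ x i)
      (p := h) (fun i _ => choiceProb_pos θ x i) (sum_choiceProb θ x) (fun i _ => Set.mem_univ _)
      ⟨i, Finset.mem_univ _, Fin.last M, Finset.mem_univ _, hne⟩
    have := (Real.lt_log_iff_exp_lt hpos).2 this
    linarith

end SoftmaxCalculus

end

/-! ### From tangent inequalities to (strict) convexity. -/

section Convexity

/-- Average the tangent inequalities based at the convex combination `z`; the linear terms cancel.
-/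
lemma convexOn_of_tangent {E : Type*} [NormedAddCommGroup E] [InnerProductSpace ℝ E]
    {f : E → ℝ} {g : E → E} (h : ∀ x y, f x + inner ℝ (g x) (y - x) ≤ f y) :
    ConvexOn ℝ Set.univ f := by
  refine ⟨convex_univ, fun x _ y _ a b ha hb hab => ?_⟩
  set z := a • x + b • y with hz
  have h0 : a * inner ℝ (g z) (x - z) + b * inner ℝ (g z) (y - z) = 0 := by
    rw [← inner_smul_right, ← inner_smul_right, ← inner_add_right]
    have : a • (x - z) + b • (y - z) = z - (a + b) • z := by rw [hz]; module
    rw [this, hab, one_smul, sub_self, inner_zero_right]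
  have h1 := mul_le_mul_of_nonneg_left (h z x) ha
  have h2 := mul_le_mul_of_nonneg_left (h z y) hb
  have h3 : (a + b) * f z = f z := by rw [hab, one_mul]
  simp only [smul_eq_mul]
  linarith

lemma strictConvexOn_of_tangent {E : Type*} [NormedAddCommGroup E] [InnerProductSpace ℝ E]
    {f : E → ℝ} {g : E → E} (h : ∀ x y, x ≠ y → f x + inner ℝ (g x) (y - x) < f y) :
    StrictConvexOn ℝ Set.univ f := by
  refine ⟨convex_univ, fun x _ y _ hxy a b ha hb hab => ?_⟩
  set z := a • x + b • y with hz
  have h0 : a * inner ℝ (g z) (x - z) + b * inner ℝ (g z) (y - z) = 0 := by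
    rw [← inner_smul_right, ← inner_smul_right, ← inner_add_right]
    have : a • (x - z) + b • (y - z) = z - (a + b) • z := by rw [hz]; module
    rw [this, hab, one_smul, sub_self, inner_zero_right]
  -- The hypothesis is strict only between distinct points, so `z` must differ from both ends.
  have hzx : z ≠ x := fun e => hxy <| by
    have h1 : b • (x - y) = 0 := by
      have : b • (x - y) = (a + b) • x - z := by rw [hz]; module
      rw [this, hab, one_smul, e, sub_self]
    exact sub_eq_zero.1 ((smul_eq_zero.1 h1).resolve_left hb.ne')
  have hzy : z ≠ y := fun e => hxy <| by
    have h1 : a • (x - y) = 0 := by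
      have : a • (x - y) = z - (a + b) • y := by rw [hz]; module
      rw [this, hab, one_smul, e, sub_self]
    exact sub_eq_zero.1 ((smul_eq_zero.1 h1).resolve_left ha.ne')
  have h1 := mul_lt_mul_of_pos_left (h z x hzx) ha
  have h2 := mul_lt_mul_of_pos_left (h z y hzy) hb
  have h3 : (a + b) * f z = f z := by rw [hab, one_mul]
  simp only [smul_eq_mul]
  linarith

variable {d M : ℕ}

lemma designMatrix_relToLast (x : Explanatory d M) (a : Fin d) (i : Fin (M + 1)) :
    designMatrix (relToLast x) a i = relToLast x i a := by
  by_cases h : i = Fin.last M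
  · subst h
    simp [designMatrix, relToLast_last]
  · simp [designMatrix, h]

lemma designMatrix_mul_transpose_apply (x : Explanatory d M) (a b : Fin d) :
    (designMatrix (relToLast x) * (designMatrix (relToLast x)).transpose) a b =
      ∑ i, relToLast x i a * relToLast x i b := by
  simp only [Matrix.mul_apply, Matrix.transpose_apply, designMatrix_relToLast]

lemma inner_toEuclideanCLM_designMatrix (x : Explanatory d M) (v : EuclideanSpace ℝ (Fin d)) :
    inner ℝ v (Matrix.toEuclideanCLM (𝕜 := ℝ)
      (designMatrix (relToLast x) * (designMatrix (relToLast x)).transpose) v) =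
      ∑ i, (inner ℝ (relToLast x i) v) ^ 2 := by
  have h (i : Fin (M + 1)) : inner ℝ (relToLast x i) v = ∑ a, v a * relToLast x i a := by
    simp [PiLp.inner_apply]
  simp only [Matrix.inner_toEuclideanCLM, dotProduct, Matrix.mulVec,
    designMatrix_mul_transpose_apply, h, sq, Finset.sum_mul_sum]
  simp only [Finset.sum_mul, Finset.mul_sum]
  simp_rw [fun a => Finset.sum_comm (s := Finset.univ (α := Fin d))
    (t := Finset.univ (α := Fin (M + 1))) (f := fun b i =>
      v.ofLp a * (relToLast x i a * relToLast x i b * v.ofLp b))]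
  rw [Finset.sum_comm]
  refine Finset.sum_congr rfl fun i _ => Finset.sum_congr rfl fun a _ =>
    Finset.sum_congr rfl fun b _ => ?_
  ring

/-- The quadratic form at `v` is an average of sums of squares of these inner products. This
nondegeneracy serves both strict convexity and the positive definiteness of `J`. -/
lemma exists_inner_ne_zero_of_posDef {n : ℕ} {x : ℕ → Explanatory d M}
    (h : (empiricalSecondMoment n x).PosDef) {v : EuclideanSpace ℝ (Fin d)} (hv : v ≠ 0) :
    ∃ k < n, ∃ i, inner ℝ (relToLast (x k) i) v ≠ 0 := by
  by_contra! hcon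
  have h1 := h.dotProduct_mulVec_pos (x := v.ofLp) (by simpa using hv)
  rw [star_trivial, ← Matrix.inner_toEuclideanCLM, empiricalSecondMoment, map_smul, map_sum,
    _root_.smul_apply, _root_.sum_apply, inner_smul_right, inner_sum,
    Finset.sum_eq_zero, mul_zero] at h1
  · exact lt_irrefl _ h1
  · intro k hk
    rw [inner_toEuclideanCLM_designMatrix]
    exact Finset.sum_eq_zero fun i _ => by rw [hcon k (Finset.mem_range.1 hk) i, sq, mul_zero]

lemma neg_logLik_tangent (n : ℕ) (x : ℕ → Explanatory d M) (c : ℕ → Fin (M + 1))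
    (θ t : EuclideanSpace ℝ (Fin d)) :
    -logLik n x c θ + inner ℝ (-∑ k ∈ Finset.range n, score (x k) (c k) θ) (t - θ) ≤
      -logLik n x c t := by
  have := Finset.sum_le_sum fun k (_ : k ∈ Finset.range n) =>
    (log_choiceProb_le_tangent (x k) (c k) θ t).1
  rw [Finset.sum_add_distrib, ← sum_inner] at this
  rw [inner_neg_left]
  simp only [logLik]
  linarith

lemma neg_logLik_tangent_strict {n : ℕ} {x : ℕ → Explanatory d M} (c : ℕ → Fin (M + 1))
    (h : (empiricalSecondMoment n x).PosDef) {θ t : EuclideanSpace ℝ (Fin d)} (hne : θ ≠ t) :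
    -logLik n x c θ + inner ℝ (-∑ k ∈ Finset.range n, score (x k) (c k) θ) (t - θ) <
      -logLik n x c t := by
  obtain ⟨k, hk, hi⟩ := exists_inner_ne_zero_of_posDef h (sub_ne_zero.2 hne.symm)
  have := Finset.sum_lt_sum
    (fun k (_ : k ∈ Finset.range n) => (log_choiceProb_le_tangent (x k) (c k) θ t).1)
    ⟨k, Finset.mem_range.2 hk, (log_choiceProb_le_tangent (x k) (c k) θ t).2 hi⟩
  rw [Finset.sum_add_distrib, ← sum_inner] at this
  rw [inner_neg_left]
  simp only [logLik]
  linarith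

end Convexity

/-! ### A locally uniform strong law of large numbers. -/

section UniformLaw

variable {Θ Z Ω : Type*} [MetricSpace Θ] [ProperSpace Θ] [TopologicalSpace Z]
  [MeasurableSpace Z] [BorelSpace Z] [MeasurableSpace Ω] {P : Measure Ω}

/-- A law of large numbers that is uniform near `θ₀`, for a continuous dominated family. -/
lemma ae_tendsto_average_nhds {f : Θ → Z → ℝ} (hf : Continuous (Function.uncurry f))
    {F : Z → ℝ} (hF : ∀ θ z, |f θ z| ≤ F z) {X : ℕ → Ω → Z} (hX : ∀ k, Measurable (X k))
    (hint : Integrable (fun ω => F (X 0 ω)) P) (hindep : iIndepFun X P)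
    (hident : ∀ k, IdentDistrib (X k) (X 0) P P) (θ₀ : Θ) :
    ∀ᵐ ω ∂P, Tendsto
      (fun q : ℕ × Θ => (q.1 : ℝ)⁻¹ * ∑ k ∈ Finset.range q.1, f q.2 (X k ω))
      (atTop ×ˢ 𝓝 θ₀) (𝓝 (∫ ω, f θ₀ (X 0 ω) ∂P)) := by
  have hfc (θ : Θ) : Continuous (f θ) := hf.comp (by fun_prop : Continuous fun z => (θ, z))
  -- Used with `C = 1` for `f θ₀` and with `C = 2` for the oscillations `w m`.
  have slln {φ : Z → ℝ} (hφ : Continuous φ) {C : ℝ} (hC : ∀ z, |φ z| ≤ C * F z) :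
      Integrable (fun ω => φ (X 0 ω)) P ∧ ∀ᵐ ω ∂P, Tendsto
        (fun n : ℕ => (n : ℝ)⁻¹ * ∑ k ∈ Finset.range n, φ (X k ω)) atTop
        (𝓝 (∫ ω, φ (X 0 ω) ∂P)) := by
    have hi : Integrable (fun ω => φ (X 0 ω)) P :=
      (hint.const_mul C).mono' (hφ.measurable.comp (hX 0)).aestronglyMeasurable
        (ae_of_all _ fun ω => hC (X 0 ω))
    refine ⟨hi, ?_⟩
    simpa [smul_eq_mul] using strong_law_ae (μ := P) (fun k ω => φ (X k ω)) hi
      (fun i j hij => (hindep.indepFun hij).comp hφ.measurable hφ.measurable)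
      (fun k => (hident k).comp hφ.measurable)
  -- The oscillation of `f · z` on the ball of radius `1 / (m + 1)`. Compactness of the ball makes
  -- it continuous in `z`; its mean tends to 0 by dominated convergence. Countably many radii keep
  -- the exceptional set null.
  set w : ℕ → Z → ℝ := fun m z =>
    sSup ((fun θ => |f θ z - f θ₀ z|) '' Metric.closedBall θ₀ (1 / ((m : ℝ) + 1))) with hw
  have hcomp (m : ℕ) : IsCompact (Metric.closedBall θ₀ (1 / ((m : ℝ) + 1))) :=
    isCompact_closedBall _ _
  have hpos (m : ℕ) : 0 < 1 / ((m : ℝ) + 1) := by positivity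
  have hdiff : Continuous fun q : Z × Θ => |f q.2 q.1 - f θ₀ q.1| := by
    have h1 : Continuous fun q : Z × Θ => f q.2 q.1 := hf.comp (continuous_snd.prodMk continuous_fst)
    have h2 : Continuous fun q : Z × Θ => f θ₀ q.1 := (hfc θ₀).comp continuous_fst
    exact (h1.sub h2).abs
  have hwc (m : ℕ) : Continuous (w m) :=
    (hcomp m).continuous_sSup (f := fun z θ => |f θ z - f θ₀ z|) hdiff
  have hle (m : ℕ) (z : Z) {θ : Θ} (hθ : θ ∈ Metric.closedBall θ₀ (1 / ((m : ℝ) + 1))) :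
      |f θ z - f θ₀ z| ≤ w m z := by
    have hc : Continuous fun θ => |f θ z - f θ₀ z| :=
      hdiff.comp (by fun_prop : Continuous fun θ : Θ => (z, θ))
    exact le_csSup ((hcomp m).bddAbove_image hc.continuousOn) ⟨θ, hθ, rfl⟩
  have hw0 (m : ℕ) (z : Z) : 0 ≤ w m z :=
    (abs_nonneg _).trans (hle m z (Metric.mem_closedBall_self (hpos m).le))
  have hwF (m : ℕ) (z : Z) : |w m z| ≤ 2 * F z := by
    rw [abs_of_nonneg (hw0 m z)]
    refine csSup_le ((Metric.nonempty_closedBall.2 (hpos m).le).image _) ?_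
    rintro _ ⟨θ, -, rfl⟩
    have := abs_sub (f θ z) (f θ₀ z)
    have := hF θ z
    have := hF θ₀ z
    simp only
    linarith
  have hwlim (z : Z) : Tendsto (fun m => w m z) atTop (𝓝 0) := by
    rw [Metric.tendsto_atTop]
    intro ε hε
    have hc : Tendsto (fun θ => |f θ z - f θ₀ z|) (𝓝 θ₀) (𝓝 0) := by
      have : Continuous fun θ => |f θ z - f θ₀ z| :=
        hdiff.comp (by fun_prop : Continuous fun θ : Θ => (z, θ))
      simpa using this.tendsto θ₀
    obtain ⟨δ, hδ, hb⟩ := Metric.eventually_nhds_iff.1 (hc.eventually (gt_mem_nhds (half_pos hε)))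
    obtain ⟨N, hN⟩ := exists_nat_one_div_lt hδ
    refine ⟨N, fun m hm => ?_⟩
    rw [Real.dist_eq, sub_zero, abs_of_nonneg (hw0 m z)]
    refine lt_of_le_of_lt ?_ (half_lt_self hε)
    refine csSup_le ((Metric.nonempty_closedBall.2 (hpos m).le).image _) ?_
    rintro _ ⟨θ, hθ, rfl⟩
    refine (hb (lt_of_le_of_lt (Metric.mem_closedBall.1 hθ) (lt_of_le_of_lt ?_ hN))).le
    exact Nat.one_div_le_one_div hm
  have hwint : Tendsto (fun m => ∫ ω, w m (X 0 ω) ∂P) atTop (𝓝 0) := by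
    have := tendsto_integral_of_dominated_convergence (μ := P) (fun ω => 2 * F (X 0 ω))
      (F := fun m ω => w m (X 0 ω)) (f := fun _ => 0)
      (fun m => ((hwc m).measurable.comp (hX 0)).aestronglyMeasurable) (hint.const_mul 2)
      (fun m => ae_of_all _ fun ω => hwF m (X 0 ω)) (ae_of_all _ fun ω => hwlim (X 0 ω))
    simpa using this
  have hall := ae_all_iff.2 fun m => (slln (hwc m) (hwF m)).2
  filter_upwards [hall, (slln (hfc θ₀) (C := 1) (by simpa using hF θ₀)).2] with ω h1 h2
  rw [Metric.tendsto_nhds]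
  intro ε hε
  -- Half of `ε` pays for moving `θ` inside the `m`-th ball, the other half for the law at `θ₀`.
  obtain ⟨m, hm⟩ := (hwint.eventually (gt_mem_nhds (half_pos hε))).exists
  have e1 := (h1 m).eventually (gt_mem_nhds hm)
  have e2 := Metric.tendsto_nhds.1 h2 _ (half_pos hε)
  have e3 : ∀ᶠ θ in 𝓝 θ₀, θ ∈ Metric.closedBall θ₀ (1 / ((m : ℝ) + 1)) :=
    Metric.closedBall_mem_nhds _ (hpos m)
  filter_upwards [(e1.and e2).prod_mk e3] with q hq
  obtain ⟨⟨hq1, hq2⟩, hq3⟩ := hq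
  rw [Real.dist_eq] at hq2 ⊢
  have hd : |(q.1 : ℝ)⁻¹ * ∑ k ∈ Finset.range q.1, f q.2 (X k ω)
      - (q.1 : ℝ)⁻¹ * ∑ k ∈ Finset.range q.1, f θ₀ (X k ω)| ≤
      (q.1 : ℝ)⁻¹ * ∑ k ∈ Finset.range q.1, w m (X k ω) := by
    rw [← mul_sub, ← Finset.sum_sub_distrib, abs_mul, abs_of_nonneg (by positivity)]
    refine mul_le_mul_of_nonneg_left ?_ (by positivity)
    exact (Finset.abs_sum_le_sum_abs _ _).trans (Finset.sum_le_sum fun k _ => hle m _ hq3)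
  have := abs_sub_le ((q.1 : ℝ)⁻¹ * ∑ k ∈ Finset.range q.1, f q.2 (X k ω))
    ((q.1 : ℝ)⁻¹ * ∑ k ∈ Finset.range q.1, f θ₀ (X k ω)) (∫ ω, f θ₀ (X 0 ω) ∂P)
  linarith

end UniformLaw

/-! ### Minimizers of convex functions with converging derivatives. -/

section Minimizers

variable {E : Type*} [NormedAddCommGroup E]

/-- If derivatives converge jointly in the index and the point, the functions are uniformly
strictly differentiable at that point. -/
lemma eventually_norm_sub_sub_le_of_tendsto_fderiv [NormedSpace ℝ E]
    {g : ℕ → E → E} {A : ℕ → E → E →L[ℝ] E} {J : E →L[ℝ] E} {θ₀ : E}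
    (hg : ∀ n θ, HasFDerivAt (g n) (A n θ) θ)
    (hA : Tendsto (fun q : ℕ × E => A q.1 q.2) (atTop ×ˢ 𝓝 θ₀) (𝓝 J)) {ε : ℝ} (hε : 0 < ε) :
    ∃ δ > 0, ∀ᶠ n in atTop, ∀ x ∈ Metric.ball θ₀ δ, ∀ y ∈ Metric.ball θ₀ δ,
      ‖g n x - g n y - J (x - y)‖ ≤ ε * ‖x - y‖ := by
  have h := Metric.tendsto_nhds.1 hA ε hε
  rw [eventually_prod_iff] at h
  obtain ⟨p, hp, q, hq, hpq⟩ := h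
  obtain ⟨δ, hδ, hb⟩ := Metric.eventually_nhds_iff_ball.1 hq
  refine ⟨δ, hδ, hp.mono fun n hn x hx y hy => ?_⟩
  have hd (z : E) (_ : z ∈ Metric.ball θ₀ δ) :
      HasFDerivWithinAt (fun t => g n t - J t) (A n z - J) (Metric.ball θ₀ δ) z :=
    ((hg n z).sub J.hasFDerivAt).hasFDerivWithinAt
  -- Mean value inequality for `g n - J`, whose derivative is at most `ε` on the ball.
  have := (convex_ball θ₀ δ).norm_image_sub_le_of_norm_hasFDerivWithin_le hd
    (fun z hz => by simpa [dist_eq_norm] using (hpq hn (hb z hz)).le) hy hx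
  convert this using 2
  rw [map_sub]
  abel

variable [InnerProductSpace ℝ E]

/-- Let `y` be the point where the segment from `θ₀` to `x` crosses the sphere. The tangent at `y`,
compared with `f θ₀ < f y`, has positive slope outwards, so `f` is larger still at `x`. -/
lemma lt_of_lt_on_sphere {f : E → ℝ} {g : E → E} {θ₀ : E} {δ : ℝ} (hδ : 0 < δ)
    (ht : ∀ x y, f x + inner ℝ (g x) (y - x) ≤ f y)
    (hs : ∀ x, ‖x - θ₀‖ = δ → f θ₀ < f x) {x : E} (hx : δ < ‖x - θ₀‖) : f θ₀ < f x := by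
  have hr : 0 < ‖x - θ₀‖ := hδ.trans hx
  set s := δ / ‖x - θ₀‖ with hs_def
  have hs0 : 0 < s := div_pos hδ hr
  have hs1 : s < 1 := (div_lt_one hr).2 hx
  set y := θ₀ + s • (x - θ₀) with hy
  have h1 : f θ₀ < f y := hs y <| by
    rw [hy, add_sub_cancel_left, norm_smul, Real.norm_of_nonneg hs0.le, hs_def]
    field_simp
  have h2 := ht y θ₀
  have h3 := ht y x
  have e2 : θ₀ - y = -(s • (x - θ₀)) := by rw [hy]; abel
  have e3 : x - y = (1 - s) • (x - θ₀) := by rw [hy]; module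
  rw [e2, inner_neg_right, inner_smul_right] at h2
  rw [e3, inner_smul_right] at h3
  have h4 : 0 < inner ℝ (g y) (x - θ₀) := by
    by_contra! hcon
    nlinarith [mul_nonpos_of_nonneg_of_nonpos hs0.le hcon]
  nlinarith [mul_pos (sub_pos.2 hs1) h4]

/-- The tangent at `θ₀` alone sees no curvature, so the tangent at the midpoint `y` is chained to
it. With `‖v‖ = δ / 2` this gives `f x - f θ₀ ≥ lam * δ ^ 2 / 8 - ‖g θ₀‖ * δ`, whence the constant
`lam * δ / 8`. -/
lemma lt_of_norm_sub_eq {f : E → ℝ} {g : E → E} {J : E →L[ℝ] E} {θ₀ x : E} {lam δ : ℝ}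
    (ht : ∀ x y, f x + inner ℝ (g x) (y - x) ≤ f y)
    (hJ : ∀ v, lam * ‖v‖ ^ 2 ≤ inner ℝ v (J v)) (hδ : 0 < δ) (hx : ‖x - θ₀‖ = δ)
    (hg : ∀ y, ‖y - θ₀‖ ≤ δ → ‖g y - g θ₀ - J (y - θ₀)‖ ≤ lam / 2 * ‖y - θ₀‖)
    (hg0 : ‖g θ₀‖ < lam * δ / 8) : f θ₀ < f x := by
  set v := (2⁻¹ : ℝ) • (x - θ₀) with hv
  have hvn : ‖v‖ = δ / 2 := by
    rw [hv, norm_smul, hx]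
    norm_num
    ring
  set y := θ₀ + v with hy
  have hyv : y - θ₀ = v := by rw [hy]; abel
  have hxy : x - y = v := by rw [hy, hv]; module
  have h1 := ht θ₀ y
  have h2 := ht y x
  rw [hyv] at h1
  rw [hxy] at h2
  have h3 := hg y (by rw [hyv, hvn]; linarith)
  rw [hyv] at h3
  have h4 : inner ℝ (g y) v = inner ℝ (g y - g θ₀ - J v) v + inner ℝ (g θ₀) v
      + inner ℝ v (J v) := by
    rw [real_inner_comm (J v) v, ← inner_add_left, ← inner_add_left]
    congr 1
    abel
  have h5 := neg_le_of_abs_le (abs_real_inner_le_norm (g y - g θ₀ - J v) v)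
  have h6 := neg_le_of_abs_le (abs_real_inner_le_norm (g θ₀) v)
  have h7 := hJ v
  have h8 := mul_le_mul_of_nonneg_right h3 (norm_nonneg v)
  have h9 := mul_lt_mul_of_pos_right hg0 hδ
  rw [hvn] at h5 h6 h7 h8
  nlinarith

/-- Outside any small ball `f n` eventually exceeds its value at `θ₀`, so the minimum over the
compact ball is global and every minimizer lies in the ball. Uniqueness comes from near-linearity of
the gradient, not from strict convexity of `f n`. -/
lemma eventually_existsUnique_minimizer [FiniteDimensional ℝ E] {f : ℕ → E → ℝ} {g : ℕ → E → E}
    {J : E →L[ℝ] E} {θ₀ : E} {lam : ℝ} (hlam : 0 < lam) (hf : ∀ n, Continuous (f n))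
    (ht : ∀ n x y, f n x + inner ℝ (g n x) (y - x) ≤ f n y)
    (hcrit : ∀ n x, IsMinOn (f n) Set.univ x → g n x = 0)
    (hJ : ∀ v, lam * ‖v‖ ^ 2 ≤ inner ℝ v (J v))
    (hg0 : Tendsto (fun n => g n θ₀) atTop (𝓝 0))
    (hg : ∀ ε > 0, ∃ δ > 0, ∀ᶠ n in atTop, ∀ x ∈ Metric.ball θ₀ δ, ∀ y ∈ Metric.ball θ₀ δ,
      ‖g n x - g n y - J (x - y)‖ ≤ ε * ‖x - y‖) :
    (∀ᶠ n in atTop, ∃! x, IsMinOn (f n) Set.univ x) ∧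
      ∀ r > 0, ∀ᶠ n in atTop, ∀ x, IsMinOn (f n) Set.univ x → ‖x - θ₀‖ < r := by
  obtain ⟨δ, hδ, hgδ⟩ := hg (lam / 2) (half_pos hlam)
  have hclose (r : ℝ) (hr : 0 < r) (hrδ : r < δ) : ∀ᶠ n in atTop,
      (∃ x, IsMinOn (f n) Set.univ x) ∧ ∀ x, IsMinOn (f n) Set.univ x → ‖x - θ₀‖ ≤ r := by
    have h0 : ∀ᶠ n in atTop, ‖g n θ₀‖ < lam * r / 8 := by
      have := hg0.norm
      rw [norm_zero] at this
      exact this.eventually (gt_mem_nhds (by positivity))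
    filter_upwards [hgδ, h0] with n h1 h2
    have hout (x : E) (hx : r < ‖x - θ₀‖) : f n θ₀ < f n x := by
      refine lt_of_lt_on_sphere hr (ht n) (fun x hx => ?_) hx
      refine lt_of_norm_sub_eq (ht n) hJ hr hx (fun y hy => ?_) h2
      exact h1 y (by rw [mem_ball_iff_norm]; linarith) θ₀ (Metric.mem_ball_self hδ)
    obtain ⟨z, hz, hzmin⟩ := (isCompact_closedBall θ₀ r).exists_isMinOn
      (Metric.nonempty_closedBall.2 hr.le) (hf n).continuousOn
    refine ⟨⟨z, fun x _ => ?_⟩, fun x hx => ?_⟩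
    · by_cases hx : ‖x - θ₀‖ ≤ r
      · exact hzmin (mem_closedBall_iff_norm.2 hx)
      · exact (hzmin (Metric.mem_closedBall_self hr.le)).trans (hout x (not_le.1 hx)).le
    · by_contra! hcon
      exact (hout x hcon).not_ge (hx (Set.mem_univ θ₀))
  refine ⟨?_, fun r hr => ?_⟩
  · filter_upwards [hgδ, hclose (δ / 2) (half_pos hδ) (half_lt_self hδ)] with n h1 h2
    obtain ⟨⟨x, hx⟩, hcl⟩ := h2
    refine ⟨x, hx, fun y hy => ?_⟩
    have hb {z : E} (hz : IsMinOn (f n) Set.univ z) : z ∈ Metric.ball θ₀ δ := by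
      rw [mem_ball_iff_norm]
      exact (hcl z hz).trans_lt (half_lt_self hδ)
    -- At two critical points the gradient terms vanish, leaving `‖J (y - x)‖ ≤ lam / 2 * ‖y - x‖`,
    -- against the coercivity constant `lam`.
    have h3 := h1 y (hb hy) x (hb hx)
    rw [hcrit n y hy, hcrit n x hx, sub_self, zero_sub, norm_neg] at h3
    have h4 := (hJ (y - x)).trans (real_inner_le_norm _ _)
    by_contra hne
    have h5 : 0 < ‖y - x‖ := norm_pos_iff.2 (sub_ne_zero.2 hne)
    nlinarith [mul_le_mul_of_nonneg_left h3 h5.le, mul_pos hlam (mul_pos h5 h5)]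
  · have hmin : 0 < min (r / 2) (δ / 2) := by positivity
    refine (hclose (min (r / 2) (δ / 2)) hmin
      (lt_of_le_of_lt (min_le_right _ _) (half_lt_self hδ))).mono fun n hn x hx => ?_
    exact (hn.2 x hx).trans_lt (lt_of_le_of_lt (min_le_left _ _) (half_lt_self hr))

end Minimizers

/-! ### Multivariate central limit theorem and whitening. -/

section CentralLimit

variable {Ω : Type*} [MeasurableSpace Ω] {P : Measure Ω} [IsProbabilityMeasure P]
  {ι : Type*} [Fintype ι] [DecidableEq ι]

/-- The central limit theorem in `ℝ^ι`, by projection to lines. -/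
lemma tendstoInDistribution_multivariateGaussian {Y : ℕ → Ω → EuclideanSpace ℝ ι}
    {S : Matrix ι ι ℝ} (hS : S.PosSemidef) (hY : MemLp (Y 0) 2 P) (hindep : iIndepFun Y P)
    (hident : ∀ k, IdentDistrib (Y k) (Y 0) P P)
    (hmean : ∀ t, ∫ ω, inner ℝ t (Y 0 ω) ∂P = 0)
    (hcov : ∀ t, ∫ ω, (inner ℝ t (Y 0 ω)) ^ 2 ∂P =
      inner ℝ t (Matrix.toEuclideanCLM (𝕜 := ℝ) S t)) :
    TendstoInDistribution (fun (n : ℕ) ω => (√(n : ℝ))⁻¹ • ∑ k ∈ Finset.range n, Y k ω) atTop id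
      (fun _ => P) (multivariateGaussian 0 S) where
  forall_aemeasurable n := by
    have (k : ℕ) := (hident k).aemeasurable_fst
    have hs : AEMeasurable (fun ω => ∑ k ∈ Finset.range n, Y k ω) P :=
      Finset.aemeasurable_fun_sum _ fun k _ => this k
    exact hs.const_smul (√(n : ℝ))⁻¹
  aemeasurable_limit := aemeasurable_id
  tendsto := by
    have hm (k : ℕ) := (hident k).aemeasurable_fst
    refine ProbabilityMeasure.tendsto_iff_tendsto_charFun.2 fun t => ?_
    set L : StrongDual ℝ (EuclideanSpace ℝ ι) := innerSL ℝ t with hL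
    have hLm : Measurable L := L.continuous.measurable
    have h2 : MemLp (fun ω => L (Y 0 ω)) 2 P := L.comp_memLp' hY
    have h0 : ∫ ω, L (Y 0 ω) ∂P = 0 := hmean t
    have hvar : Var[fun ω => L (Y 0 ω); P] = inner ℝ t (Matrix.toEuclideanCLM (𝕜 := ℝ) S t) := by
      rw [variance_of_integral_eq_zero h2.aemeasurable h0]
      exact hcov t
    have hclt := tendstoInDistribution_inv_sqrt_mul_sum_sub (P := P)
      (P' := gaussianReal 0 Var[fun ω => L (Y 0 ω); P].toNNReal) (Y := id)
      (X := fun k ω => L (Y k ω)) HasLaw.id h2 (hindep.comp (fun _ => L) fun _ => hLm)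
      (fun k => (hident k).comp hLm)
    -- The characteristic function of the projection along `t`, taken at 1, is that of the vector
    -- taken at `t`.
    have hc := ProbabilityMeasure.tendsto_iff_tendsto_charFun.1 hclt.tendsto 1
    simp only [ProbabilityMeasure.coe_mk, Measure.map_id] at hc ⊢
    rw [charFun_gaussianReal] at hc
    rw [charFun_multivariateGaussian hS]
    have e1 (n : ℕ) : charFun (P.map fun ω => (√(n : ℝ))⁻¹ • ∑ k ∈ Finset.range n, Y k ω) t =
        charFun (P.map fun ω => (√(n : ℝ))⁻¹ *
          (∑ k ∈ Finset.range n, L (Y k ω) - n * ∫ ω, L (Y 0 ω) ∂P)) 1 := by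
      have hs : AEMeasurable (fun ω => ∑ k ∈ Finset.range n, Y k ω) P :=
        Finset.aemeasurable_fun_sum _ fun k _ => hm k
      have hs' : AEMeasurable (fun ω => ∑ k ∈ Finset.range n, L (Y k ω)) P :=
        Finset.aemeasurable_fun_sum _ fun k _ => hLm.comp_aemeasurable (hm k)
      have hs1 : AEMeasurable (fun ω => (√(n : ℝ))⁻¹ • ∑ k ∈ Finset.range n, Y k ω) P :=
        hs.const_smul (√(n : ℝ))⁻¹
      rw [charFun_apply, charFun_apply, integral_map hs1 (by fun_prop), integral_map ((hs'.sub_const _).const_mul _) (by fun_prop), h0]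
      refine integral_congr_ae (ae_of_all _ fun ω => ?_)
      simp [hL, inner_smul_left, sum_inner, real_inner_comm]
    simp only [e1]
    convert hc using 2
    rw [hvar, ← Matrix.inner_toEuclideanCLM]
    have hnn : 0 ≤ inner ℝ t (Matrix.toEuclideanCLM (𝕜 := ℝ) S t) := by
      rw [← hvar]; exact variance_nonneg _ _
    simp [Real.coe_toNNReal _ hnn]

/-- Whitening a centred Gaussian vector. -/
lemma map_sqrt_multivariateGaussian {J : Matrix ι ι ℝ} (hJ : J.PosDef) :
    (multivariateGaussian 0 J⁻¹).map (Matrix.toEuclideanCLM (𝕜 := ℝ) (CFC.sqrt J)) =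
      multivariateGaussian 0 (1 : Matrix ι ι ℝ) := by
  refine Measure.ext_of_charFun ?_
  funext t
  have hB : CFC.sqrt J * CFC.sqrt J = J := CFC.sqrt_mul_sqrt_self _ hJ.posSemidef.nonneg
  have hsa : IsSelfAdjoint (Matrix.toEuclideanCLM (𝕜 := ℝ) (CFC.sqrt J)) :=
    (CFC.sqrt_nonneg J).isSelfAdjoint.map _
  have hdet : IsUnit (CFC.sqrt J).det := by
    have : IsUnit ((CFC.sqrt J).det * (CFC.sqrt J).det) := by
      rw [← Matrix.det_mul, hB]
      exact (Matrix.isUnit_iff_isUnit_det _).1 hJ.isUnit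
    exact isUnit_of_mul_isUnit_left this
  -- This product is the covariance matrix of the image measure.
  have hone : CFC.sqrt J * (J⁻¹ * CFC.sqrt J) = 1 := by
    have hinv : J⁻¹ = (CFC.sqrt J)⁻¹ * (CFC.sqrt J)⁻¹ := by
      conv_lhs => rw [← hB]
      rw [Matrix.mul_inv_rev]
    rw [hinv, Matrix.mul_assoc, Matrix.nonsing_inv_mul _ hdet, Matrix.mul_one,
      Matrix.mul_nonsing_inv _ hdet]
  have hadj (v w : EuclideanSpace ℝ ι) :
      inner ℝ (Matrix.toEuclideanCLM (𝕜 := ℝ) (CFC.sqrt J) v) w =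
        inner ℝ v (Matrix.toEuclideanCLM (𝕜 := ℝ) (CFC.sqrt J) w) := by
    rw [← ContinuousLinearMap.adjoint_inner_right, hsa.adjoint_eq]
  have hcf : charFun ((multivariateGaussian 0 J⁻¹).map
      (Matrix.toEuclideanCLM (𝕜 := ℝ) (CFC.sqrt J))) t =
      charFun (multivariateGaussian 0 J⁻¹) (Matrix.toEuclideanCLM (𝕜 := ℝ) (CFC.sqrt J) t) := by
    rw [charFun_apply, charFun_apply, integral_map (by fun_prop) (by fun_prop)]
    refine integral_congr_ae (ae_of_all _ fun x => ?_)
    simp only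
    rw [hadj]
  rw [hcf, charFun_multivariateGaussian hJ.inv.posSemidef,
    charFun_multivariateGaussian Matrix.PosSemidef.one, ← Matrix.inner_toEuclideanCLM,
    ← Matrix.inner_toEuclideanCLM, hadj t (Matrix.toEuclideanCLM (𝕜 := ℝ) J⁻¹ _),
    ← mul_apply_eq_comp, ← mul_apply_eq_comp, ← map_mul, ← map_mul,
    Matrix.mul_assoc, hone]
  simp

end CentralLimit

/-! ### Moments of the score and positive definiteness of the information matrix. -/

section Moments

variable {d M : ℕ} {Ω : Type*} [MeasurableSpace Ω] {P : Measure Ω}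
  {θ₀ : EuclideanSpace ℝ (Fin d)} {x : ℕ → Ω → Explanatory d M} {c : ℕ → Ω → Fin (M + 1)}

lemma measurable_relToLast : Measurable (relToLast : Explanatory d M → Explanatory d M) :=
  continuous_relToLast.measurable

/-- Condition on `x 0`: the factor `φ (x 0)` pulls out, and the indicator becomes the softmax
probability. -/
lemma IsSoftmaxSample.integral_indicator [IsProbabilityMeasure P]
    (hs : IsSoftmaxSample P θ₀ x c)
    {φ : Explanatory d M → ℝ} (hφ : Measurable φ) (hint : Integrable (fun ω => φ (x 0 ω)) P)
    (i : Fin (M + 1)) :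
    ∫ ω, φ (x 0 ω) * (c 0 ⁻¹' {i}).indicator (fun _ => (1 : ℝ)) ω ∂P =
      ∫ ω, φ (x 0 ω) * choiceProb θ₀ (x 0 ω) i ∂P := by
  have hm := (hs.measurable_x 0).comap_le
  have hc : MeasurableSet (c 0 ⁻¹' {i}) := hs.measurable_c 0 (MeasurableSet.singleton i)
  have hprod : Integrable (fun ω => φ (x 0 ω) *
      (c 0 ⁻¹' {i}).indicator (fun _ => (1 : ℝ)) ω) P := by
    refine (hint.indicator hc).congr (ae_of_all _ fun ω => ?_)
    by_cases h : ω ∈ c 0 ⁻¹' {i} <;> simp [h]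
  have hsm : StronglyMeasurable[MeasurableSpace.comap (x 0) inferInstance]
      (fun ω => φ (x 0 ω)) :=
    (hφ.comp (comap_measurable (x 0))).stronglyMeasurable
  rw [← integral_condExp hm]
  refine integral_congr_ae ?_
  have h1 := condExp_mul_of_stronglyMeasurable_left (μ := P) hsm hprod
    ((integrable_const (1 : ℝ)).indicator hc)
  filter_upwards [h1, hs.condProb 0 i] with ω h1 h2
  rw [← h2]
  exact h1

lemma integrable_choiceProb_mul (hx : Measurable (x 0)) {φ : Ω → ℝ} (hφ : Integrable φ P)
    (i : Fin (M + 1)) : Integrable (fun ω => choiceProb θ₀ (x 0 ω) i * φ ω) P := by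
  have hp : Measurable fun ω => choiceProb θ₀ (x 0 ω) i :=
    ((continuous_choiceProb i).comp (by fun_prop : Continuous fun z => (θ₀, z))).measurable.comp hx
  refine hφ.norm.mono' (hp.aestronglyMeasurable.mul hφ.1) (ae_of_all _ fun ω => ?_)
  rw [norm_mul, Real.norm_of_nonneg (choiceProb_pos _ _ _).le]
  exact mul_le_of_le_one_left (norm_nonneg _) (choiceProb_le_one _ _ _)

/-- Averaging over the chosen option given the explanatory variables. -/
lemma IsSoftmaxSample.integral_choice [IsProbabilityMeasure P]
    (hs : IsSoftmaxSample P θ₀ x c)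
    {h : Explanatory d M → Fin (M + 1) → ℝ} (hh : ∀ i, Measurable fun z => h z i)
    (hint : ∀ i, Integrable (fun ω => h (x 0 ω) i) P) :
    ∫ ω, h (x 0 ω) (c 0 ω) ∂P = ∫ ω, ∑ i, choiceProb θ₀ (x 0 ω) i * h (x 0 ω) i ∂P := by
  have hc (i : Fin (M + 1)) : MeasurableSet (c 0 ⁻¹' {i}) :=
    hs.measurable_c 0 (MeasurableSet.singleton i)
  have e (ω : Ω) : h (x 0 ω) (c 0 ω) =
      ∑ i, h (x 0 ω) i * (c 0 ⁻¹' {i}).indicator (fun _ => (1 : ℝ)) ω := by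
    rw [Finset.sum_eq_single (c 0 ω)]
    · rw [Set.indicator_of_mem (by rfl), mul_one]
    · intro i _ hi
      rw [Set.indicator_of_notMem (fun h => hi h.symm), mul_zero]
    · exact fun h => absurd (Finset.mem_univ _) h
  simp_rw [e]
  rw [integral_finsetSum, integral_finsetSum]
  · refine Finset.sum_congr rfl fun i _ => ?_
    rw [hs.integral_indicator (hh i) (hint i)]
    simp only [mul_comm]
  · intro i _
    exact integrable_choiceProb_mul (hs.measurable_x 0) (hint i) i
  · intro i _
    refine ((hint i).indicator (hc i)).congr (ae_of_all _ fun ω => ?_)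
    by_cases h : ω ∈ c 0 ⁻¹' {i} <;> simp [h]

/-- The trace is the sum of the squared Euclidean norms of the options, while the norm on
`Explanatory` is their maximum. -/
lemma norm_sq_relToLast_le (z : Explanatory d M) :
    ‖relToLast z‖ ^ 2 ≤
      ∑ a, (designMatrix (relToLast z) * (designMatrix (relToLast z)).transpose) a a := by
  have h : ∑ a, (designMatrix (relToLast z) * (designMatrix (relToLast z)).transpose) a a =
      ∑ i, ‖relToLast z i‖ ^ 2 := by
    simp only [designMatrix_mul_transpose_apply, EuclideanSpace.norm_sq_eq, Real.norm_eq_abs,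
      sq_abs]
    rw [Finset.sum_comm]
    simp only [sq]
  rw [h]
  have hnn : 0 ≤ ∑ i, ‖relToLast z i‖ ^ 2 := by positivity
  refine (Real.le_sqrt (norm_nonneg _) hnn).1
    ((pi_norm_le_iff_of_nonneg (Real.sqrt_nonneg _)).2 fun i => Real.le_sqrt_of_sq_le ?_)
  exact Finset.single_le_sum (f := fun i => ‖relToLast z i‖ ^ 2) (fun _ _ => by positivity)
    (Finset.mem_univ i)

lemma integrable_norm_sq_relToLast (hx : Measurable (x 0))
    (hint : ∀ a b, Integrable (fun ω => (designMatrix (relToLast (x 0 ω)) *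
      (designMatrix (relToLast (x 0 ω))).transpose) a b) P) :
    Integrable (fun ω => ‖relToLast (x 0 ω)‖ ^ 2) P := by
  refine (integrable_finsetSum Finset.univ fun a _ => hint a a).mono'
    ((measurable_relToLast.comp hx).norm.pow_const 2).aestronglyMeasurable
    (ae_of_all _ fun ω => ?_)
  rw [Real.norm_of_nonneg (by positivity)]
  exact norm_sq_relToLast_le _

lemma choiceCov_relToLast (θ : EuclideanSpace ℝ (Fin d)) (z : Explanatory d M) :
    choiceCov θ (relToLast z) = choiceCov θ z := by
  rw [← obsInfo_eq (relToLast z) (Fin.last M), obsInfo_relToLast, obsInfo_eq]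

lemma infoMatrix_apply (a b : Fin d) : infoMatrix P θ₀ x c a b =
    ∫ ω, choiceCov θ₀ (relToLast (x 0 ω)) a b ∂P := by
  simp only [infoMatrix, Matrix.of_apply, obsInfo_eq, choiceCov_relToLast]

lemma measurable_score (θ : EuclideanSpace ℝ (Fin d)) :
    Measurable fun q : Explanatory d M × Fin (M + 1) => score q.1 q.2 θ :=
  measurable_from_prod_countable_left fun i =>
    ((continuous_score i).comp (by fun_prop : Continuous fun z => (θ, z))).measurable

lemma integrable_choiceCov_relToLast (hx : Measurable (x 0))
    (hR : Integrable (fun ω => ‖relToLast (x 0 ω)‖ ^ 2) P)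
    (θ : EuclideanSpace ℝ (Fin d)) (a b : Fin d) :
    Integrable (fun ω => choiceCov θ (relToLast (x 0 ω)) a b) P := by
  have hc : Continuous fun z : Explanatory d M => choiceCov θ z a b :=
    (continuous_choiceCov.comp (by fun_prop : Continuous fun z => (θ, z))).matrix_elem a b
  exact (hR.const_mul 4).mono'
    (hc.measurable.comp (measurable_relToLast.comp hx)).aestronglyMeasurable
    (ae_of_all _ fun ω => abs_choiceCov_le _ _ _ _)

lemma inner_infoMatrix (hx : Measurable (x 0))
    (hR : Integrable (fun ω => ‖relToLast (x 0 ω)‖ ^ 2) P)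
    (v : EuclideanSpace ℝ (Fin d)) :
    inner ℝ v (Matrix.toEuclideanCLM (𝕜 := ℝ) (infoMatrix P θ₀ x c) v) =
      ∫ ω, ∑ i, choiceProb θ₀ (x 0 ω) i *
        (inner ℝ v (score (relToLast (x 0 ω)) i θ₀)) ^ 2 ∂P := by
  have h (ω : Ω) := inner_toEuclideanCLM_choiceCov θ₀ (relToLast (x 0 ω)) v v
  simp only [choiceProb_relToLast, ← sq] at h
  simp only [← h, Matrix.inner_toEuclideanCLM, dotProduct, Matrix.mulVec, infoMatrix_apply]
  have hi := integrable_choiceCov_relToLast hx hR θ₀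
  rw [integral_finsetSum]
  · refine Finset.sum_congr rfl fun a _ => ?_
    rw [integral_const_mul, integral_finsetSum]
    · simp only [integral_mul_const]
    · exact fun b _ => (hi a b).mul_const _
  · exact fun a _ => (integrable_finsetSum _ fun b _ => (hi a b).mul_const _).const_mul _

lemma memLp_two_score_relToLast (hx : Measurable (x 0))
    (hR : Integrable (fun ω => ‖relToLast (x 0 ω)‖ ^ 2) P)
    (i : Fin (M + 1)) (θ : EuclideanSpace ℝ (Fin d)) :
    MemLp (fun ω => score (relToLast (x 0 ω)) i θ) 2 P := by
  have hm : AEStronglyMeasurable (fun ω => relToLast (x 0 ω)) P :=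
    (measurable_relToLast.comp hx).aestronglyMeasurable
  have h2 : MemLp (fun ω => relToLast (x 0 ω)) 2 P := (memLp_two_iff_integrable_sq_norm hm).2 hR
  refine (h2.norm.const_mul 2).mono' ?_ (ae_of_all _ fun ω => norm_score_le _ _ _)
  exact ((measurable_score θ).comp
    ((measurable_relToLast.comp hx).prodMk measurable_const)).aestronglyMeasurable

lemma IsSoftmaxSample.integral_inner_score [IsProbabilityMeasure P]
    (hs : IsSoftmaxSample P θ₀ x c)
    (hR : Integrable (fun ω => ‖relToLast (x 0 ω)‖ ^ 2) P)
    (v : EuclideanSpace ℝ (Fin d)) :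
    ∫ ω, inner ℝ v (score (relToLast (x 0 ω)) (c 0 ω) θ₀) ∂P = 0 := by
  have hm (i : Fin (M + 1)) :
      Measurable fun z : Explanatory d M => inner ℝ v (score (relToLast z) i θ₀) :=
    ((measurable_score θ₀).comp (measurable_relToLast.prodMk measurable_const)).const_inner
  rw [hs.integral_choice (h := fun z i => inner ℝ v (score (relToLast z) i θ₀)) hm fun i =>
    ((memLp_two_score_relToLast (hs.measurable_x 0) hR i θ₀).const_inner v).integrable
      (by norm_num)]
  refine integral_eq_zero_of_ae (ae_of_all _ fun ω => ?_)
  have := sum_choiceProb_smul_score θ₀ (relToLast (x 0 ω))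
  simp only [choiceProb_relToLast] at this
  simp only [← inner_smul_right, ← inner_sum, this, inner_zero_right, Pi.zero_apply]

/-- The information equality: the score has covariance matrix `J`. -/
lemma IsSoftmaxSample.integral_inner_score_sq [IsProbabilityMeasure P]
    (hs : IsSoftmaxSample P θ₀ x c)
    (hR : Integrable (fun ω => ‖relToLast (x 0 ω)‖ ^ 2) P)
    (v : EuclideanSpace ℝ (Fin d)) :
    ∫ ω, (inner ℝ v (score (relToLast (x 0 ω)) (c 0 ω) θ₀)) ^ 2 ∂P =
      inner ℝ v (Matrix.toEuclideanCLM (𝕜 := ℝ) (infoMatrix P θ₀ x c) v) := by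
  have hm (i : Fin (M + 1)) :
      Measurable fun z : Explanatory d M => (inner ℝ v (score (relToLast z) i θ₀)) ^ 2 :=
    ((measurable_score θ₀).comp
      (measurable_relToLast.prodMk measurable_const)).const_inner.pow_const 2
  rw [hs.integral_choice (h := fun z i => (inner ℝ v (score (relToLast z) i θ₀)) ^ 2) hm fun i =>
    ((memLp_two_score_relToLast (hs.measurable_x 0) hR i θ₀).const_inner v).integrable_sq,
    inner_infoMatrix (hs.measurable_x 0) hR]

/-- If the form vanished at `v ≠ 0`, then, as all choice probabilities are positive, almost surely
every option's score would be orthogonal to `v`, hence every relative vector too. By identical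
distribution this would hold for all observations, so no empirical second moment could be positive
definite with positive probability. -/
lemma IsSoftmaxSample.infoMatrix_posDef [IsProbabilityMeasure P]
    (hs : IsSoftmaxSample P θ₀ x c)
    (hR : Integrable (fun ω => ‖relToLast (x 0 ω)‖ ^ 2) P)
    (hpos : ∃ n, 0 < P {ω | (empiricalSecondMoment n (fun k => x k ω)).PosDef}) :
    (infoMatrix P θ₀ x c).PosDef := by
  refine Matrix.PosDef.of_dotProduct_mulVec_pos
    (Matrix.IsHermitian.ext fun a b => ?_) fun {w} hw => ?_
  · simp only [infoMatrix_apply, star_trivial, choiceCov_comm θ₀ _ a b]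
  set v : EuclideanSpace ℝ (Fin d) := WithLp.toLp 2 w with hv
  have hv0 : v ≠ 0 := by simpa [hv] using hw
  have hq := inner_infoMatrix (P := P) (θ₀ := θ₀) (c := c) (hs.measurable_x 0) hR v
  have hnn (ω : Ω) : 0 ≤ ∑ i, choiceProb θ₀ (x 0 ω) i *
      (inner ℝ v (score (relToLast (x 0 ω)) i θ₀)) ^ 2 :=
    Finset.sum_nonneg fun i _ => mul_nonneg (choiceProb_pos _ _ _).le (sq_nonneg _)
  rw [star_trivial]
  change 0 < v.ofLp ⬝ᵥ _
  rw [← Matrix.inner_toEuclideanCLM, hq]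
  refine lt_of_le_of_ne (integral_nonneg hnn) fun hzero => ?_
  have hint : Integrable (fun ω => ∑ i, choiceProb θ₀ (x 0 ω) i *
      (inner ℝ v (score (relToLast (x 0 ω)) i θ₀)) ^ 2) P :=
    integrable_finsetSum _ fun i _ => integrable_choiceProb_mul (hs.measurable_x 0)
      ((memLp_two_score_relToLast (hs.measurable_x 0) hR i θ₀).const_inner v).integrable_sq i
  have hae := (integral_eq_zero_iff_of_nonneg hnn hint).1 hzero.symm
  have hae0 : ∀ᵐ ω ∂P, ∀ i, inner ℝ (relToLast (x 0 ω) i) v = 0 := by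
    filter_upwards [hae] with ω hω i
    have h1 (i : Fin (M + 1)) : inner ℝ v (score (relToLast (x 0 ω)) i θ₀) = 0 := by
      have := (Finset.sum_eq_zero_iff_of_nonneg fun i _ =>
        mul_nonneg (choiceProb_pos _ _ _).le (sq_nonneg _)).1 hω i (Finset.mem_univ i)
      simpa [(choiceProb_pos θ₀ (x 0 ω) i).ne'] using this
    have h2 := h1 i
    have h3 := h1 (Fin.last M)
    -- The last relative vector is 0, so its score shows that the mean is orthogonal to `v`; the
    -- score of option `i` then gives the rest.
    rw [score, inner_sub_right] at h2 h3
    rw [relToLast_last, inner_zero_right] at h3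
    rw [real_inner_comm]
    linarith
  have haek (k : ℕ) : ∀ᵐ ω ∂P, ∀ i, inner ℝ (relToLast (x k ω) i) v = 0 := by
    have hid : IdentDistrib (x 0) (x k) P P := ((hs.ident k).comp measurable_fst).symm
    refine hid.ae_snd (p := fun z => ∀ i, inner ℝ (relToLast z i) v = 0) ?_ hae0
    have : IsClosed {z : Explanatory d M | ∀ i, inner ℝ (relToLast z i) v = 0} := by
      simp only [Set.ofPred_forall]
      refine isClosed_iInter fun i => isClosed_eq ?_ continuous_const
      have := continuous_relToLast (d := d) (M := M)
      fun_prop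
    exact this.measurableSet
  obtain ⟨n, hn⟩ := hpos
  refine hn.ne' (measure_mono_null (fun ω hω => ?_) (ae_iff.1 (ae_all_iff.2 haek)))
  obtain ⟨k, -, i, hi⟩ := exists_inner_ne_zero_of_posDef hω hv0
  exact fun hcon => hi (hcon k i)

end Moments

/-! ### The estimator along a fixed data sequence. -/

section Deterministic

variable {d M : ℕ}

lemma score_relToLast (x : Explanatory d M) (c : Fin (M + 1)) (θ : EuclideanSpace ℝ (Fin d)) :
    score (relToLast x) c θ = score x c θ := by
  have h : choiceMean θ (relToLast x) = choiceMean θ x - x (Fin.last M) := by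
    simp only [choiceMean, choiceProb_relToLast]
    simp only [relToLast, smul_sub, Finset.sum_sub_distrib, ← Finset.sum_smul, sum_choiceProb,
      one_smul]
  simp only [score, h, relToLast]
  abel

lemma Matrix.PosDef.exists_mul_norm_sq_le {J : Matrix (Fin d) (Fin d) ℝ} (hJ : J.PosDef) :
    ∃ lam > 0, ∀ v, lam * ‖v‖ ^ 2 ≤ inner ℝ v (Matrix.toEuclideanCLM (𝕜 := ℝ) J v) := by
  -- The constant is the minimum of the form on the unit sphere, which is empty when `d = 0`.
  rcases (Metric.sphere (0 : EuclideanSpace ℝ (Fin d)) 1).eq_empty_or_nonempty with he | hne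
  · refine ⟨1, one_pos, fun v => ?_⟩
    have hv : v = 0 := by
      by_contra hv
      have : (‖v‖⁻¹ • v) ∈ Metric.sphere (0 : EuclideanSpace ℝ (Fin d)) 1 := by
        simp [norm_smul, hv]
      rw [he] at this
      exact this
    simp [hv]
  · have hc : Continuous fun v => inner ℝ v (Matrix.toEuclideanCLM (𝕜 := ℝ) J v) := by fun_prop
    obtain ⟨w, hw, hmin⟩ := (isCompact_sphere (0 : EuclideanSpace ℝ (Fin d)) 1).exists_isMinOn
      hne hc.continuousOn
    have hw0 : w ≠ 0 := fun h => by simp [h] at hw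
    refine ⟨inner ℝ w (Matrix.toEuclideanCLM (𝕜 := ℝ) J w), ?_, fun v => ?_⟩
    · rw [Matrix.inner_toEuclideanCLM]
      simpa using hJ.dotProduct_mulVec_pos (x := w.ofLp) (by simpa using hw0)
    · rcases eq_or_ne v 0 with rfl | hv
      · simp
      · have h1 : (‖v‖⁻¹ • v) ∈ Metric.sphere (0 : EuclideanSpace ℝ (Fin d)) 1 := by
          simp [norm_smul, hv]
        have h2 := hmin h1
        simp only [Set.mem_ofPred_eq, map_smul, inner_smul_left, inner_smul_right,
          conj_trivial] at h2
        have h3 : 0 < ‖v‖ := norm_pos_iff.2 hv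
        calc _ ≤ ‖v‖⁻¹ * (‖v‖⁻¹ * inner ℝ v (Matrix.toEuclideanCLM (𝕜 := ℝ) J v)) * ‖v‖ ^ 2 :=
              mul_le_mul_of_nonneg_right h2 (by positivity)
          _ = _ := by field_simp

lemma continuous_toEuclideanCLM : Continuous
    (Matrix.toEuclideanCLM (𝕜 := ℝ) (n := Fin d)) :=
  LinearMap.continuous_of_finiteDimensional
    (Matrix.toEuclideanCLM (𝕜 := ℝ) (n := Fin d)).toAlgEquiv.toLinearMap

lemma continuous_toEuclideanCLM_symm : Continuous
    (Matrix.toEuclideanCLM (𝕜 := ℝ) (n := Fin d)).symm :=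
  LinearMap.continuous_of_finiteDimensional
    (Matrix.toEuclideanCLM (𝕜 := ℝ) (n := Fin d)).symm.toAlgEquiv.toLinearMap

/-- The average score of the first `n` observations. -/
noncomputable def meanScore (n : ℕ) (x : ℕ → Explanatory d M) (c : ℕ → Fin (M + 1))
    (θ : EuclideanSpace ℝ (Fin d)) : EuclideanSpace ℝ (Fin d) :=
  (n : ℝ)⁻¹ • ∑ k ∈ Finset.range n, score (x k) (c k) θ

lemma hasFDerivAt_meanScore (n : ℕ) (x : ℕ → Explanatory d M) (c : ℕ → Fin (M + 1))
    (θ : EuclideanSpace ℝ (Fin d)) :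
    HasFDerivAt (meanScore n x c)
      (-Matrix.toEuclideanCLM (𝕜 := ℝ) (empiricalInfo n x c θ)) θ := by
  refine ((HasFDerivAt.fun_sum fun k _ =>
    hasFDerivAt_score (x k) (c k) θ).const_smul (n : ℝ)⁻¹).congr_fderiv ?_
  rw [empiricalInfo_eq, map_smul, map_sum, Finset.sum_neg_distrib]
  ext1 v
  simp

lemma hasFDerivAt_logLik (n : ℕ) (x : ℕ → Explanatory d M) (c : ℕ → Fin (M + 1))
    (θ : EuclideanSpace ℝ (Fin d)) :
    HasFDerivAt (logLik n x c) (innerSL ℝ (∑ k ∈ Finset.range n, score (x k) (c k) θ)) θ := by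
  rw [map_sum]
  exact HasFDerivAt.fun_sum fun k _ => hasFDerivAt_log_choiceProb (x k) (c k) θ

lemma meanScore_eq_zero_of_isMaxOn {n : ℕ} {x : ℕ → Explanatory d M} {c : ℕ → Fin (M + 1)}
    {θ : EuclideanSpace ℝ (Fin d)} (h : IsMaxOn (logLik n x c) Set.univ θ) :
    meanScore n x c θ = 0 := by
  have h1 := (h.isLocalMax univ_mem).hasFDerivAt_eq_zero (hasFDerivAt_logLik n x c θ)
  have h2 : ∑ k ∈ Finset.range n, score (x k) (c k) θ = 0 := by
    have := DFunLike.congr_fun h1 (∑ k ∈ Finset.range n, score (x k) (c k) θ)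
    rw [innerSL_apply_apply] at this
    exact inner_self_eq_zero.1 this
  rw [meanScore, h2, smul_zero]

/-- Consistency and asymptotic linearity of the maximum likelihood estimator along a fixed
sequence of observations. -/
lemma mle_consistent_and_linear {x : ℕ → Explanatory d M} {c : ℕ → Fin (M + 1)}
    {θ₀ : EuclideanSpace ℝ (Fin d)} {J : Matrix (Fin d) (Fin d) ℝ}
    {θhat : ℕ → EuclideanSpace ℝ (Fin d)} (hJ : J.PosDef)
    (hinfo : Tendsto (fun q : ℕ × EuclideanSpace ℝ (Fin d) => empiricalInfo q.1 x c q.2)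
      (atTop ×ˢ 𝓝 θ₀) (𝓝 J))
    (hscore : Tendsto (fun n => meanScore n x c θ₀) atTop (𝓝 0))
    (hmax : ∀ n, (∃ θ, IsMaxOn (logLik n x c) Set.univ θ) →
      IsMaxOn (logLik n x c) Set.univ (θhat n)) :
    (∀ᶠ n in atTop, ∀ θ, IsMaxOn (logLik n x c) Set.univ θ ↔ θ = θhat n) ∧
      Tendsto θhat atTop (𝓝 θ₀) ∧
      ∀ ε > 0, ∀ᶠ n in atTop,
        ‖Matrix.toEuclideanCLM (𝕜 := ℝ) J⁻¹ (meanScore n x c θ₀) - (θhat n - θ₀)‖ ≤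
          ε * ‖θhat n - θ₀‖ := by
  obtain ⟨lam, hlam, hJlam⟩ := hJ.exists_mul_norm_sq_le
  have hstrict (ε : ℝ) (hε : 0 < ε) := eventually_norm_sub_sub_le_of_tendsto_fderiv
    (g := fun n θ => -meanScore n x c θ)
    (A := fun n θ => Matrix.toEuclideanCLM (𝕜 := ℝ) (empiricalInfo n x c θ))
    (fun n θ => (hasFDerivAt_meanScore n x c θ).neg.congr_fderiv (neg_neg _))
    ((continuous_toEuclideanCLM.tendsto J).comp hinfo) hε
  have hmin {n : ℕ} (hn : 0 < n) (θ : EuclideanSpace ℝ (Fin d)) :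
      IsMinOn (fun t => (n : ℝ)⁻¹ * -logLik n x c t) Set.univ θ ↔
        IsMaxOn (logLik n x c) Set.univ θ := by
    have : 0 < (n : ℝ)⁻¹ := by positivity
    simp only [isMinOn_iff, isMaxOn_iff, mul_le_mul_iff_right₀ this, neg_le_neg_iff]
  have hcrit (n : ℕ) (θ : EuclideanSpace ℝ (Fin d))
      (h : IsMinOn (fun t => (n : ℝ)⁻¹ * -logLik n x c t) Set.univ θ) :
      -meanScore n x c θ = 0 := by
    -- For `n = 0` the factor `n⁻¹` is 0: every point minimizes, but the mean score is zero as well.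
    rcases n.eq_zero_or_pos with rfl | hn
    · simp [meanScore]
    · rw [meanScore_eq_zero_of_isMaxOn ((hmin hn θ).1 h), neg_zero]
  obtain ⟨hex, hclose⟩ := eventually_existsUnique_minimizer
    (f := fun n θ => (n : ℝ)⁻¹ * -logLik n x c θ) (g := fun n θ => -meanScore n x c θ) hlam
    (fun n => continuous_const.mul (continuous_iff_continuousAt.2 fun θ =>
      (hasFDerivAt_logLik n x c θ).continuousAt).neg)
    (fun n θ t => by
      have := mul_le_mul_of_nonneg_left (neg_logLik_tangent n x c θ t)
        (inv_nonneg.2 (Nat.cast_nonneg n) : (0 : ℝ) ≤ (n : ℝ)⁻¹)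
      rw [mul_add, ← real_inner_smul_left, smul_neg] at this
      exact this)
    hcrit hJlam (by simpa using hscore.neg) hstrict
  have hmle : ∀ᶠ n in atTop, ∀ θ, IsMaxOn (logLik n x c) Set.univ θ ↔ θ = θhat n := by
    filter_upwards [hex, eventually_gt_atTop 0] with n h1 hn θ
    obtain ⟨t, ht, hu⟩ := h1
    have h2 := hmax n ⟨t, (hmin hn t).1 ht⟩
    refine ⟨fun h => ?_, fun h => h ▸ h2⟩
    rw [hu θ ((hmin hn θ).2 h), hu (θhat n) ((hmin hn _).2 h2)]
  have hlim : Tendsto θhat atTop (𝓝 θ₀) := by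
    rw [Metric.tendsto_nhds]
    intro r hr
    filter_upwards [hclose r hr, hmle, eventually_gt_atTop 0] with n h1 h2 hn
    rw [dist_eq_norm]
    exact h1 _ ((hmin hn _).2 ((h2 _).2 rfl))
  refine ⟨hmle, hlim, fun ε hε => ?_⟩
  set K : EuclideanSpace ℝ (Fin d) →L[ℝ] EuclideanSpace ℝ (Fin d) :=
    Matrix.toEuclideanCLM (𝕜 := ℝ) J⁻¹ with hK
  have hKJ (v : EuclideanSpace ℝ (Fin d)) : K (Matrix.toEuclideanCLM (𝕜 := ℝ) J v) = v := by
    rw [hK, ← mul_apply_eq_comp, ← map_mul, Matrix.nonsing_inv_mul _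
      ((Matrix.isUnit_iff_isUnit_det _).1 hJ.isUnit), map_one]
    rfl
  -- Applying `K` costs a factor `‖K‖`; the `+ 1` keeps the denominator positive if `K = 0`.
  obtain ⟨δ, hδ, hev⟩ := hstrict (ε / (‖K‖ + 1)) (by positivity)
  filter_upwards [hev, hlim.eventually (Metric.ball_mem_nhds θ₀ hδ), hmle] with n h1 h2 h3
  have h4 := h1 _ h2 θ₀ (Metric.mem_ball_self hδ)
  simp only [meanScore_eq_zero_of_isMaxOn ((h3 _).2 rfl), neg_zero, zero_sub, neg_neg] at h4
  calc ‖K (meanScore n x c θ₀) - (θhat n - θ₀)‖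
      = ‖K (meanScore n x c θ₀ - Matrix.toEuclideanCLM (𝕜 := ℝ) J (θhat n - θ₀))‖ := by
        rw [map_sub K, hKJ]
    _ ≤ ‖K‖ * (ε / (‖K‖ + 1) * ‖θhat n - θ₀‖) := (K.le_opNorm _).trans (by gcongr)
    _ = (‖K‖ / (‖K‖ + 1)) * (ε * ‖θhat n - θ₀‖) := by ring
    _ ≤ 1 * (ε * ‖θhat n - θ₀‖) := by
        gcongr
        rw [div_le_one (by positivity)]
        linarith
    _ = ε * ‖θhat n - θ₀‖ := one_mul _

end Deterministic

/-! ### Transfer of limits in distribution under relative errors. -/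

section Slutsky

variable {Ω E : Type*} [MeasurableSpace Ω] {P : Measure Ω} [IsProbabilityMeasure P]
  [NormedAddCommGroup E] [MeasurableSpace E] [BorelSpace E]

lemma tendstoInDistribution_id_of_map_eq {Ω' : Type*} [MeasurableSpace Ω'] {μ : Measure Ω'}
    [IsProbabilityMeasure μ] {ν : Measure E} [IsProbabilityMeasure ν] {X : ℕ → Ω → E}
    {Z : Ω' → E} (h : TendstoInDistribution X atTop Z (fun _ => P) μ) (hν : μ.map Z = ν) :
    TendstoInDistribution X atTop id (fun _ => P) ν where
  forall_aemeasurable := h.forall_aemeasurable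
  aemeasurable_limit := aemeasurable_id
  tendsto := by
    have h1 : (⟨ν.map id, Measure.isProbabilityMeasure_map aemeasurable_id⟩ :
        ProbabilityMeasure E) =
        ⟨μ.map Z, Measure.isProbabilityMeasure_map h.aemeasurable_limit⟩ :=
      Subtype.ext (by simp [hν])
    rw [h1]
    exact h.tendsto

/-- Two sequences whose difference is negligible relative to one of them have the same limit in
distribution. -/
lemma tendstoInDistribution_of_relative_error [NormedSpace ℝ E] [SecondCountableTopology E]
    {μ : Measure E} [IsProbabilityMeasure μ] {Z D : ℕ → Ω → E}
    (hZ : TendstoInDistribution Z atTop id (fun _ => P) μ) (hD : ∀ n, AEMeasurable (D n) P)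
    (h : ∀ᵐ ω ∂P, ∀ ε > 0, ∀ᶠ n in atTop, ‖Z n ω - D n ω‖ ≤ ε * ‖D n ω‖) :
    TendstoInDistribution D atTop id (fun _ => P) μ := by
  have hZm := hZ.forall_aemeasurable
  -- Dividing the error by `‖Z‖` gives `D = Z + ‖Z‖ • W` with `W → 0`, so Slutsky applies to a
  -- continuous function of `(Z, W)` and no separate tightness argument is needed. Where `Z = 0`,
  -- the error bound forces `D = 0`, so the identity eventually holds there too.
  set W : ℕ → Ω → E := fun n ω => ‖Z n ω‖⁻¹ • (D n ω - Z n ω) with hW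
  have hWm (n : ℕ) : AEMeasurable (W n) P := (hZm n).norm.inv.smul ((hD n).sub (hZm n))
  -- The hypothesis measures the error against `D`; this converts it to `Z`, whose limit is known.
  have hhalf {ω : Ω} {n : ℕ} (hn : ‖Z n ω - D n ω‖ ≤ 1 / 2 * ‖D n ω‖) :
      ‖D n ω‖ ≤ 2 * ‖Z n ω‖ := by
    have := norm_sub_norm_le (D n ω) (Z n ω)
    rw [norm_sub_rev] at this
    linarith
  have hW0 : TendstoInMeasure P W atTop fun _ => 0 := by
    refine tendstoInMeasure_of_tendsto_ae (fun n => (hWm n).aestronglyMeasurable) ?_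
    filter_upwards [h] with ω hω
    rw [Metric.tendsto_nhds]
    intro ε hε
    filter_upwards [hω (1 / 2) (by norm_num), hω (ε / 4) (by positivity)] with n h1 h2
    rw [dist_zero_right, hW, norm_smul, norm_inv, norm_norm, norm_sub_rev]
    rcases eq_or_lt_of_le (norm_nonneg (Z n ω)) with h0 | h0
    · rw [← h0, inv_zero, zero_mul]
      exact hε
    · rw [inv_mul_lt_iff₀ h0]
      nlinarith [hhalf h1]
  have hs := hZ.continuous_comp_prodMk_of_tendstoInMeasure_const
    (g := fun q : E × E => q.1 + ‖q.1‖ • q.2) (by fun_prop) hW0 hWm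
  simp only [smul_zero, add_zero] at hs
  refine tendstoInDistribution_of_tendstoInMeasure_sub D id hs ?_ hD
  refine tendstoInMeasure_of_tendsto_ae
    (fun n => ((hD n).sub (hs.forall_aemeasurable n)).aestronglyMeasurable) ?_
  filter_upwards [h] with ω hω
  refine tendsto_const_nhds.congr' ?_
  filter_upwards [hω (1 / 2) (by norm_num)] with n h1
  simp only [Pi.sub_apply, Pi.zero_apply, hW]
  rcases eq_or_ne (Z n ω) 0 with h0 | h0
  · have : D n ω = 0 := by simpa [h0] using hhalf h1
    simp [h0, this]
  · rw [smul_smul, mul_inv_cancel₀ (norm_ne_zero_iff.2 h0), one_smul]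
    abel

end Slutsky

/-! ### Limit theorems for the empirical information and the mean score. -/

section SampleLimits

variable {d M : ℕ} {Ω : Type*} [MeasurableSpace Ω] {P : Measure Ω}
  {θ₀ : EuclideanSpace ℝ (Fin d)} {x : ℕ → Ω → Explanatory d M} {c : ℕ → Ω → Fin (M + 1)}

lemma IsSoftmaxSample.iIndepFun_score (hs : IsSoftmaxSample P θ₀ x c) :
    iIndepFun (fun k ω => score (x k ω) (c k ω) θ₀) P :=
  hs.indep.comp (fun _ q => score q.1 q.2 θ₀) fun _ => measurable_score θ₀

lemma IsSoftmaxSample.identDistrib_score (hs : IsSoftmaxSample P θ₀ x c) (k : ℕ) :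
    IdentDistrib (fun ω => score (x k ω) (c k ω) θ₀) (fun ω => score (x 0 ω) (c 0 ω) θ₀) P P :=
  (hs.ident k).comp (measurable_score θ₀)

lemma IsSoftmaxSample.ae_tendsto_empiricalInfo (hs : IsSoftmaxSample P θ₀ x c)
    (hR : Integrable (fun ω => ‖relToLast (x 0 ω)‖ ^ 2) P) :
    ∀ᵐ ω ∂P, Tendsto (fun q : ℕ × EuclideanSpace ℝ (Fin d) =>
      empiricalInfo q.1 (fun k => x k ω) (fun k => c k ω) q.2)
      (atTop ×ˢ 𝓝 θ₀) (𝓝 (infoMatrix P θ₀ x c)) := by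
  have hindep : iIndepFun (fun k ω => relToLast (x k ω)) P :=
    hs.indep.comp (fun _ q => relToLast q.1) fun _ => measurable_relToLast.comp measurable_fst
  have hident (k : ℕ) :
      IdentDistrib (fun ω => relToLast (x k ω)) (fun ω => relToLast (x 0 ω)) P P :=
    (hs.ident k).comp (measurable_relToLast.comp measurable_fst)
  have h (a b : Fin d) := ae_tendsto_average_nhds
    (f := fun (θ : EuclideanSpace ℝ (Fin d)) (z : Explanatory d M) => choiceCov θ z a b)
    (continuous_choiceCov.matrix_elem a b) (fun θ z => abs_choiceCov_le θ z a b)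
    (fun k => measurable_relToLast.comp (hs.measurable_x k)) (hR.const_mul 4) hindep hident θ₀
  filter_upwards [ae_all_iff.2 fun a => ae_all_iff.2 fun b => h a b] with ω hω
  refine tendsto_pi_nhds.2 fun a => tendsto_pi_nhds.2 fun b => ?_
  rw [infoMatrix_apply]
  refine (hω a b).congr fun q => ?_
  simp only [Function.comp_apply, choiceCov_relToLast, empiricalInfo_eq, Matrix.smul_apply, Matrix.sum_apply,
    smul_eq_mul]

lemma IsSoftmaxSample.memLp_two_score (hs : IsSoftmaxSample P θ₀ x c)
    (hR : Integrable (fun ω => ‖relToLast (x 0 ω)‖ ^ 2) P) :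
    MemLp (fun ω => score (x 0 ω) (c 0 ω) θ₀) 2 P := by
  have hm : AEStronglyMeasurable (fun ω => relToLast (x 0 ω)) P :=
    (measurable_relToLast.comp (hs.measurable_x 0)).aestronglyMeasurable
  have h2 : MemLp (fun ω => relToLast (x 0 ω)) 2 P := (memLp_two_iff_integrable_sq_norm hm).2 hR
  refine (h2.norm.const_mul 2).mono'
    (hs.identDistrib_score 0).aemeasurable_fst.aestronglyMeasurable (ae_of_all _ fun ω => ?_)
  rw [← score_relToLast]
  exact norm_score_le _ _ _

lemma IsSoftmaxSample.ae_tendsto_meanScore [IsProbabilityMeasure P]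
    (hs : IsSoftmaxSample P θ₀ x c)
    (hR : Integrable (fun ω => ‖relToLast (x 0 ω)‖ ^ 2) P) :
    ∀ᵐ ω ∂P, Tendsto (fun n => meanScore n (fun k => x k ω) (fun k => c k ω) θ₀) atTop (𝓝 0) := by
  have hi : Integrable (fun ω => score (x 0 ω) (c 0 ω) θ₀) P :=
    (hs.memLp_two_score hR).integrable (by norm_num)
  have h0 : ∫ ω, score (x 0 ω) (c 0 ω) θ₀ ∂P = 0 := by
    refine ext_inner_left ℝ fun v => ?_
    rw [← integral_inner hi, inner_zero_right]
    simpa only [score_relToLast] using hs.integral_inner_score hR v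
  have := strong_law_ae (μ := P) (fun k ω => score (x k ω) (c k ω) θ₀) hi
    (fun i j hij => hs.iIndepFun_score.indepFun hij) hs.identDistrib_score
  rwa [h0] at this

lemma IsSoftmaxSample.tendstoInDistribution_meanScore [IsProbabilityMeasure P]
    (hs : IsSoftmaxSample P θ₀ x c)
    (hR : Integrable (fun ω => ‖relToLast (x 0 ω)‖ ^ 2) P)
    (hJ : (infoMatrix P θ₀ x c).PosDef) :
    TendstoInDistribution (fun (n : ℕ) ω => √(n : ℝ) • Matrix.toEuclideanCLM (𝕜 := ℝ)
      (infoMatrix P θ₀ x c)⁻¹ (meanScore n (fun k => x k ω) (fun k => c k ω) θ₀)) atTop id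
      (fun _ => P) (multivariateGaussian 0 (infoMatrix P θ₀ x c)⁻¹) := by
  set J := infoMatrix P θ₀ x c with hJdef
  set K := Matrix.toEuclideanCLM (𝕜 := ℝ) J⁻¹ with hK
  have hKm : Measurable K := K.continuous.measurable
  have hKsa : IsSelfAdjoint K := hJ.inv.isHermitian.isSelfAdjoint.map _
  have hadj (v w : EuclideanSpace ℝ (Fin d)) : inner ℝ v (K w) = inner ℝ (K v) w := by
    rw [← ContinuousLinearMap.adjoint_inner_left, hKsa.adjoint_eq]
  have hJK (v : EuclideanSpace ℝ (Fin d)) : Matrix.toEuclideanCLM (𝕜 := ℝ) J (K v) = v := by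
    rw [hK, ← mul_apply_eq_comp, ← map_mul, Matrix.mul_nonsing_inv _
      ((Matrix.isUnit_iff_isUnit_det _).1 hJ.isUnit), map_one]
    rfl
  have hclt := tendstoInDistribution_multivariateGaussian (P := P)
    (Y := fun k ω => K (score (x k ω) (c k ω) θ₀)) hJ.inv.posSemidef
    (K.comp_memLp' (hs.memLp_two_score hR)) (hs.iIndepFun_score.comp (fun _ => K) fun _ => hKm)
    (fun k => (hs.identDistrib_score k).comp hKm)
    (fun t => by
      simp only [hadj]
      simpa only [score_relToLast] using hs.integral_inner_score hR (K t))
    (fun t => by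
      simp only [hadj]
      have := hs.integral_inner_score_sq hR (K t)
      simp only [score_relToLast] at this
      -- With `K = J⁻¹` symmetric, the covariance `K J K` of the transformed score collapses to `K`.
      rw [this, hJK, real_inner_comm])
  refine hclt.congr (fun n => ae_of_all _ fun ω => ?_) EventuallyEq.rfl
  have : √(n : ℝ) * (n : ℝ)⁻¹ = (√(n : ℝ))⁻¹ := by
    rcases n.eq_zero_or_pos with rfl | hn
    · simp
    · have h : (0 : ℝ) < n := by exact_mod_cast hn
      rw [← div_eq_mul_inv, Real.sqrt_div_self', one_div]
  simp only [meanScore, map_smul, map_sum, smul_smul, this]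

end SampleLimits

/-! ### Normalization by the square root of the empirical information. -/

section Studentization

variable {d M : ℕ}

open scoped Matrix.Norms.L2Operator in
lemma continuousOn_matrix_sqrt :
    ContinuousOn (CFC.sqrt : Matrix (Fin d) (Fin d) ℝ → Matrix (Fin d) (Fin d) ℝ)
      {A | A.PosSemidef} := by
  have := CFC.continuousOn_sqrt (A := Matrix (Fin d) (Fin d) ℝ)
  simpa only [Matrix.nonneg_iff_posSemidef] using this

lemma isClosed_posSemidef : IsClosed {A : Matrix (Fin d) (Fin d) ℝ | A.PosSemidef} := by
  have : {A : Matrix (Fin d) (Fin d) ℝ | A.PosSemidef} =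
      {A | A.transpose = A} ∩ ⋂ v : Fin d → ℝ, {A | 0 ≤ v ⬝ᵥ A.mulVec v} := by
    ext A
    simp only [Set.mem_ofPred_eq, Set.mem_inter_iff, Set.mem_iInter]
    refine ⟨fun h => ⟨by simpa using h.isHermitian.eq, fun v => by
      simpa using h.dotProduct_mulVec_nonneg v⟩, fun h => ?_⟩
    exact Matrix.PosSemidef.of_dotProduct_mulVec_nonneg (by
      rw [Matrix.IsHermitian, Matrix.conjTranspose_eq_transpose_of_trivial]
      exact h.1) fun v => by simpa using h.2 v
  rw [this]
  refine (isClosed_eq (by fun_prop) continuous_id).inter (isClosed_iInter fun v =>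
    isClosed_le continuous_const ?_)
  exact continuous_const.dotProduct (continuous_id.matrix_mulVec continuous_const)

variable {Ω : Type*} [MeasurableSpace Ω] {P : Measure Ω}

lemma aemeasurable_toEuclideanCLM_sqrt {A : Ω → Matrix (Fin d) (Fin d) ℝ}
    (hA : AEMeasurable (fun ω => Matrix.toEuclideanCLM (𝕜 := ℝ) (A ω)) P)
    (hpos : ∀ ω, (A ω).PosSemidef) :
    AEMeasurable (fun ω => Matrix.toEuclideanCLM (𝕜 := ℝ) (CFC.sqrt (A ω))) P := by
  classical
  set T := Matrix.toEuclideanCLM (𝕜 := ℝ) (n := Fin d) with hT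
  set s := T.symm ⁻¹' {A | A.PosSemidef} with hs_def
  have hs : IsClosed s := isClosed_posSemidef.preimage continuous_toEuclideanCLM_symm
  have hc : ContinuousOn (fun B => T (CFC.sqrt (T.symm B))) s :=
    continuous_toEuclideanCLM.comp_continuousOn
      (continuousOn_matrix_sqrt.comp continuous_toEuclideanCLM_symm.continuousOn fun _ h => h)
  -- The square root is continuous only on the positive semidefinite cone; as the cone is closed,
  -- extension by 0 is Borel.
  have hm : Measurable (s.piecewise (fun B => T (CFC.sqrt (T.symm B))) fun _ => 0) :=
    hc.measurable_piecewise continuousOn_const hs.measurableSet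
  refine (hm.comp_aemeasurable hA).congr (ae_of_all _ fun ω => ?_)
  have : T (A ω) ∈ s := by simpa [hs_def] using hpos ω
  simp [Set.piecewise_eq_of_mem _ _ _ this]

lemma aemeasurable_toEuclideanCLM_empiricalInfo {x : ℕ → Ω → Explanatory d M}
    {c : ℕ → Ω → Fin (M + 1)} {θ : Ω → EuclideanSpace ℝ (Fin d)}
    (hx : ∀ k, Measurable (x k)) (hθ : AEMeasurable θ P) (n : ℕ) :
    AEMeasurable (fun ω => Matrix.toEuclideanCLM (𝕜 := ℝ)
      (empiricalInfo n (fun k => x k ω) (fun k => c k ω) (θ ω))) P := by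
  have hc : Continuous fun q : EuclideanSpace ℝ (Fin d) × Explanatory d M =>
      Matrix.toEuclideanCLM (𝕜 := ℝ) (choiceCov q.1 q.2) :=
    continuous_toEuclideanCLM.comp continuous_choiceCov
  have h (k : ℕ) : AEMeasurable (fun ω => Matrix.toEuclideanCLM (𝕜 := ℝ)
      (choiceCov (θ ω) (x k ω))) P := by
    have hcm := hc.measurable
    have hp : AEMeasurable (fun ω => (θ ω, x k ω)) P := hθ.prodMk (hx k).aemeasurable
    simpa only [Function.comp_def] using hcm.comp_aemeasurable hp
  have hsum : AEMeasurable (fun ω => ∑ k ∈ Finset.range n, Matrix.toEuclideanCLM (𝕜 := ℝ)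
      (choiceCov (θ ω) (x k ω))) P := Finset.aemeasurable_fun_sum _ fun k _ => h k
  have hsmul : Measurable fun B : EuclideanSpace ℝ (Fin d) →L[ℝ] EuclideanSpace ℝ (Fin d) =>
    (n : ℝ)⁻¹ • B := (continuous_const_smul _).measurable
  refine (hsmul.comp_aemeasurable hsum).congr (ae_of_all _ fun ω => ?_)
  simp only [empiricalInfo_eq, map_smul, map_sum, Function.comp_apply]

/-- Studentization: multiplying by the square root of a consistent estimator of the inverse
limiting covariance matrix. -/
lemma tendstoInDistribution_sqrt_smul [IsProbabilityMeasure P]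
    {J : Matrix (Fin d) (Fin d) ℝ} (hJ : J.PosDef) {D : ℕ → Ω → EuclideanSpace ℝ (Fin d)}
    {A : ℕ → Ω → Matrix (Fin d) (Fin d) ℝ}
    (hD : TendstoInDistribution D atTop id (fun _ => P) (multivariateGaussian 0 J⁻¹))
    (hAm : ∀ n, AEMeasurable (fun ω => Matrix.toEuclideanCLM (𝕜 := ℝ) (A n ω)) P)
    (hpos : ∀ n ω, (A n ω).PosSemidef)
    (hA : ∀ᵐ ω ∂P, Tendsto (fun n => A n ω) atTop (𝓝 J)) :
    TendstoInDistribution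
      (fun n ω => Matrix.toEuclideanCLM (𝕜 := ℝ) (CFC.sqrt (A n ω)) (D n ω)) atTop id
      (fun _ => P) (multivariateGaussian 0 (1 : Matrix (Fin d) (Fin d) ℝ)) := by
  have hm (n : ℕ) := aemeasurable_toEuclideanCLM_sqrt (hAm n) (hpos n)
  have hlim : TendstoInMeasure P
      (fun n ω => Matrix.toEuclideanCLM (𝕜 := ℝ) (CFC.sqrt (A n ω))) atTop
      fun _ => Matrix.toEuclideanCLM (𝕜 := ℝ) (CFC.sqrt J) := by
    refine tendstoInMeasure_of_tendsto_ae (fun n => (hm n).aestronglyMeasurable) ?_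
    filter_upwards [hA] with ω hω
    refine (continuous_toEuclideanCLM.tendsto _).comp
      ((continuousOn_matrix_sqrt J hJ.posSemidef).tendsto.comp ?_)
    exact tendsto_nhdsWithin_iff.2 ⟨hω, Eventually.of_forall fun n => hpos n ω⟩
  -- Slutsky for the jointly continuous evaluation of an operator at a vector.
  have h := hD.continuous_comp_prodMk_of_tendstoInMeasure_const
    (g := fun q : EuclideanSpace ℝ (Fin d) ×
      (EuclideanSpace ℝ (Fin d) →L[ℝ] EuclideanSpace ℝ (Fin d)) => q.2 q.1) (by fun_prop) hlim hm
  exact tendstoInDistribution_id_of_map_eq h (map_sqrt_multivariateGaussian hJ)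

end Studentization

/-! ### The main theorem. -/

theorem theorem1 {d M : ℕ} :
    -- the maximum likelihood problem is convex, strictly so for a positive definite matrix
    (∀ (n : ℕ) (x : ℕ → Explanatory d M) (c : ℕ → Fin (M + 1)),
      ConvexOn ℝ Set.univ (fun θ => -logLik n x c θ) ∧
      ((empiricalSecondMoment n x).PosDef →
        StrictConvexOn ℝ Set.univ (fun θ => -logLik n x c θ))) ∧
    -- the maximum likelihood estimator is asymptotically normal
    (∀ {Ω : Type*} [MeasurableSpace Ω] (P : Measure Ω) [IsProbabilityMeasure P]
      (θ₀ : EuclideanSpace ℝ (Fin d)) (x : ℕ → Ω → Explanatory d M)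
      (c : ℕ → Ω → Fin (M + 1)) (θhat : ℕ → Ω → EuclideanSpace ℝ (Fin d)),
      IsSoftmaxSample P θ₀ x c →
      -- the second-moment matrix exists and its empirical version is positive definite
      (∀ a b, Integrable (fun ω => (designMatrix (relToLast (x 0 ω)) *
        (designMatrix (relToLast (x 0 ω))).transpose) a b) P) →
      (∃ n, 0 < P {ω | (empiricalSecondMoment n (fun k => x k ω)).PosDef}) →
      IsMLEstimator P x c θhat →
      (∀ᵐ ω ∂P, (∀ᶠ n in atTop, ∀ θ,
          IsMaxOn (logLik n (fun k => x k ω) (fun k => c k ω)) Set.univ θ ↔ θ = θhat n ω) ∧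
        Tendsto (fun n => θhat n ω) atTop (𝓝 θ₀)) ∧
      (∀ a b, Integrable (fun ω => obsInfo (x 0 ω) (c 0 ω) θ₀ a b) P) ∧
      (infoMatrix P θ₀ x c).PosDef ∧
      (∀ᵐ ω ∂P, Tendsto
        (fun n => empiricalInfo n (fun k => x k ω) (fun k => c k ω) (θhat n ω)) atTop
        (𝓝 (infoMatrix P θ₀ x c))) ∧
      TendstoInDistribution (fun (n : ℕ) ω => √(n : ℝ) • (θhat n ω - θ₀)) atTop id
        (fun _ => P) (multivariateGaussian 0 (infoMatrix P θ₀ x c)⁻¹) ∧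
      TendstoInDistribution
        (fun (n : ℕ) ω => Matrix.toEuclideanCLM (𝕜 := ℝ)
          (CFC.sqrt (empiricalInfo n (fun k => x k ω) (fun k => c k ω) (θhat n ω)))
          (√(n : ℝ) • (θhat n ω - θ₀))) atTop id
        (fun _ => P) (multivariateGaussian 0 (1 : Matrix (Fin d) (Fin d) ℝ))) := by
  refine ⟨fun n x c => ⟨convexOn_of_tangent (neg_logLik_tangent n x c), fun h =>
    strictConvexOn_of_tangent fun _ _ hne => neg_logLik_tangent_strict c h hne⟩, ?_⟩
  intro Ω _ P _ θ₀ x c θhat hs hint hpos hmle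
  have hR := integrable_norm_sq_relToLast (hs.measurable_x 0) hint
  have hJ := hs.infoMatrix_posDef hR hpos
  have hinfo := hs.ae_tendsto_empiricalInfo hR
  have hall := (hinfo.and ((hs.ae_tendsto_meanScore hR).and (ae_all_iff.2 hmle.isMax))).mono
    fun ω h => mle_consistent_and_linear hJ h.1 h.2.1 h.2.2
  have hJhat : ∀ᵐ ω ∂P, Tendsto
      (fun n => empiricalInfo n (fun k => x k ω) (fun k => c k ω) (θhat n ω)) atTop
      (𝓝 (infoMatrix P θ₀ x c)) := by
    filter_upwards [hinfo, hall] with ω h1 h2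
    -- The joint limit in `(n, θ)` is what permits inserting the random point `θhat n ω`.
    simpa only [Function.comp_def, id_eq] using h1.comp (tendsto_id.prodMk h2.2.1)
  have hD : TendstoInDistribution (fun (n : ℕ) ω => √(n : ℝ) • (θhat n ω - θ₀)) atTop id
      (fun _ => P) (multivariateGaussian 0 (infoMatrix P θ₀ x c)⁻¹) := by
    have hDm (n : ℕ) : AEMeasurable (fun ω => √(n : ℝ) • (θhat n ω - θ₀)) P := by
      have := (hmle.aemeasurable n).sub_const θ₀
      exact this.const_smul (√(n : ℝ))
    have hZ := hs.tendstoInDistribution_meanScore hR hJ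
    refine tendstoInDistribution_of_relative_error hZ hDm ?_
    filter_upwards [hall] with ω hω ε hε
    filter_upwards [hω.2.2 ε hε] with n hn
    rw [← smul_sub, norm_smul, norm_smul, mul_left_comm]
    exact mul_le_mul_of_nonneg_left hn (norm_nonneg _)
  refine ⟨hall.mono fun ω hω => ⟨hω.1, hω.2.1⟩, fun a b => ?_, hJ, hJhat, hD, ?_⟩
  · have := integrable_choiceCov_relToLast (hs.measurable_x 0) hR θ₀ a b
    simpa only [obsInfo_eq, choiceCov_relToLast] using this
  · exact tendstoInDistribution_sqrt_smul hJ hD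
      (fun n => aemeasurable_toEuclideanCLM_empiricalInfo hs.measurable_x (hmle.aemeasurable n) n)
      (fun n ω => empiricalInfo_posSemidef _ _ _ _) hJhat
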